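/- A class of functions $\mathbb N^n\to\mathbb N$ ($n\ge 0$) is called good if it contains the constant functions, the projections, the successor function and the modified difference $x\dot- y=\max\{0,x-y\}$, and is closed under composition and bounded summation $f(\bar x,y)=\sum_{i=0}^{y}g(\bar x,i)$. The lower elementary functions are the elements of the smallest good class. A function $\mathbb N^n\to\mathbb N^m$ is lower elementary if all its components are. Represent $\mathbb Q$ in $\mathbb N^3$ by $\iota(z/n)=(\max(z,0),-\min(0,z),n)$ for reduced $z/n$ with $n>0$, and $\pi(p,m,n)=(p-m)/n$ if $n>0$, $\pi(p,m,0)=0$; represent $\mathbb N$ by itself and products componentwise. A function $f$ between finite products of copies of $\mathbb Q$ and $\mathbb N$ is lower elementary if $\iota\circ f\circ\pi$ is. For an open set $O\subseteq\mathbb R^N$ and an integer $e\ge 1$, let $O_e$ be the set of all $x\in O$ with $|x|\le e$ and $|x-y|\ge \frac1e$ for all $y\in\mathbb R^N\setminus O$, where $|\cdot|$ is the maximum norm. A function $F:O\to\mathbb R^M$ is lower elementary if there are a strictly increasing lower elementary function $d:\mathbb N\to\mathbb N$ and a lower elementary function $f:\mathbb Q^N\times\mathbb N\to\mathbb Q^M$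 such that for all integers $e\ge 1$, all $a\in\mathbb Q^N$ and all $x\in O_e$, $$|x-a|<\frac1{d(e)}\ \Longrightarrow\ |F(x)-f(a,e)|<\frac1e .$$ Identify $\mathbb C$ with $\mathbb R^2$. **Theorem.** For every real $r>0$, the Riemann zeta function $\zeta$ is lower elementary on the punctured disk $\{z\in\mathbb C\mid 0<|z-1|<r\}$ (here $|z-1|$ is the usual absolute value). -/

import Mathlib

namespace GoodClasses

/-- A good class of functions `ℕⁿ → ℕ` (all arities `n`): it contains the constants, the projections,
the successor and the modified difference, and it is closed under composition and bounded
summation `f(x̄, y) = ∑_{i = 0}^{y} g(x̄, i)`. -/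
structure IsGoodClass (C : ∀ n : ℕ, Set ((Fin n → ℕ) → ℕ)) : Prop where
  const : ∀ n c : ℕ, (fun _ : Fin n → ℕ => c) ∈ C n
  proj : ∀ (n : ℕ) (i : Fin n), (fun v : Fin n → ℕ => v i) ∈ C n
  succ : (fun v : Fin 1 → ℕ => v 0 + 1) ∈ C 1
  sub : (fun v : Fin 2 → ℕ => v 0 - v 1) ∈ C 2
  comp : ∀ (m n : ℕ) (g : (Fin m → ℕ) → ℕ) (h : Fin m → (Fin n → ℕ) → ℕ),
    g ∈ C m → (∀ i, h i ∈ C n) → (fun v => g (fun i => h i v)) ∈ C n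
  bsum : ∀ (n : ℕ) (g : (Fin (n + 1) → ℕ) → ℕ), g ∈ C (n + 1) →
    (fun v : Fin (n + 1) → ℕ =>
      ∑ i ∈ Finset.range (v (Fin.last n) + 1), g (Function.update v (Fin.last n) i)) ∈ C (n + 1)

/-- The lower elementary functions: the smallest good class. -/
def lowerElementary (n : ℕ) : Set ((Fin n → ℕ) → ℕ) :=
  {f | ∀ C : ∀ n : ℕ, Set ((Fin n → ℕ) → ℕ), IsGoodClass C → f ∈ C n}

theorem isGoodClass_lowerElementary : IsGoodClass lowerElementary where
  const n c _ hC := hC.const n c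
  proj n i _ hC := hC.proj n i
  succ _ hC := hC.succ
  sub _ hC := hC.sub
  comp m n g h hg hh C hC := hC.comp m n g h (hg C hC) (fun i => hh i C hC)
  bsum n g hg C hC := hC.bsum n g (hg C hC)

/-- A presentation of `X` as a retract of `ℕᵏ`: maps `ι : X → ℕᵏ` and `π : ℕᵏ → X` with
`π ∘ ι = id`. -/
structure Retract (X : Type) where
  dim : ℕ
  ι : X → (Fin dim → ℕ)
  π : (Fin dim → ℕ) → X
  π_ι : ∀ x, π (ι x) = x

/-- `ℕ` as a retract of `ℕ¹`. -/
def Retract.nat : Retract ℕ where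
  dim := 1
  ι n := fun _ => n
  π v := v 0
  π_ι _ := rfl

/-- `ℚ` as a retract of `ℕ³`, through `ℚ → ℤ × ℕ → ℕ² × ℕ`: a reduced fraction `z / n` with
`n > 0` goes to `(max z 0, -min 0 z, n)`, and `(p, m, n)` goes back to `(p - m) / n` if `n > 0`
and to `0` otherwise. -/
def Retract.rat : Retract ℚ where
  dim := 3
  ι q := ![(max q.num 0).toNat, (-min 0 q.num).toNat, q.den]
  π v := if 0 < v 2 then (((v 0 : ℤ) - (v 1 : ℤ) : ℤ) : ℚ) / (v 2 : ℚ) else 0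
  π_ι q := by
    have h : (((max q.num 0).toNat : ℤ) - ((-min 0 q.num).toNat : ℤ)) = q.num := by omega
    refine (if_pos q.den_pos).trans ?_
    change ((((max q.num 0).toNat : ℤ) - ((-min 0 q.num).toNat : ℤ) : ℤ) : ℚ) / (q.den : ℚ) = q
    rw [h]
    exact Rat.num_div_den q

/-- The product of two retracts. -/
def Retract.prod {X Y : Type} (R : Retract X) (S : Retract Y) : Retract (X × Y) where
  dim := R.dim + S.dim
  ι p := Fin.append (R.ι p.1) (S.ι p.2)
  π v := (R.π (fun i => v (Fin.castAdd S.dim i)), S.π (fun j => v (Fin.natAdd R.dim j)))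
  π_ι p := by simp [R.π_ι, S.π_ι]

/-- The `N`-th power of a retract. -/
def Retract.pow {X : Type} (R : Retract X) (N : ℕ) : Retract (Fin N → X) where
  dim := N * R.dim
  ι x := fun k => R.ι (x (finProdFinEquiv.symm k).1) (finProdFinEquiv.symm k).2
  π v := fun i => R.π (fun j => v (finProdFinEquiv (i, j)))
  π_ι x := by
    funext i
    simp only [Equiv.symm_apply_apply]
    exact R.π_ι (x i)

/-- `f : X → Y` is in the class `C` if all components of `ι ∘ f ∘ π` are. -/
def Retract.MapIn (C : ∀ n : ℕ, Set ((Fin n → ℕ) → ℕ)) {X Y : Type} (R : Retract X)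
    (S : Retract Y) (f : X → Y) : Prop :=
  ∀ j : Fin S.dim, (fun v : Fin R.dim → ℕ => S.ι (f (R.π v)) j) ∈ C R.dim

/-- `O_e`: the points of `O` of norm at most `e` and of distance at least `1 / e` to the complement
of `O`. The norm and the distance on `Fin N → ℝ` are those of the maximum norm. -/
def innerPart {N : ℕ} (O : Set (Fin N → ℝ)) (e : ℕ) : Set (Fin N → ℝ) :=
  {x | x ∈ O ∧ ‖x‖ ≤ e ∧ ∀ y, y ∉ O → 1 / (e : ℝ) ≤ dist x y}

/-- `F : O → ℝᴹ` is in the class `C`, for an open subset `O` of `ℝᴺ` (only the values of `F`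
on `O` matter). -/
def FunctionIn (C : ∀ n : ℕ, Set ((Fin n → ℕ) → ℕ)) {N M : ℕ} (O : Set (Fin N → ℝ))
    (F : (Fin N → ℝ) → (Fin M → ℝ)) : Prop :=
  ∃ (d : ℕ → ℕ) (f : (Fin N → ℚ) × ℕ → (Fin M → ℚ)),
    StrictMono d ∧
    Retract.nat.MapIn C Retract.nat d ∧
    ((Retract.rat.pow N).prod Retract.nat).MapIn C (Retract.rat.pow M) f ∧
    ∀ e : ℕ, 0 < e → ∀ a : Fin N → ℚ, ∀ x ∈ innerPart O e,
      dist x (fun i => (a i : ℝ)) < 1 / (d e : ℝ) →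
        dist (F x) (fun j => (f (a, e) j : ℝ)) < 1 / (e : ℝ)

/-- `F : D → ℂ` is lower elementary, for an open subset `D` of `ℂ`, identified with `ℝ²`. -/
def IsLowerElementaryOn (F : ℂ → ℂ) (D : Set ℂ) : Prop :=
  FunctionIn lowerElementary {x : Fin 2 → ℝ | (⟨x 0, x 1⟩ : ℂ) ∈ D}
    (fun x => ![(F ⟨x 0, x 1⟩).re, (F ⟨x 0, x 1⟩).im])

end GoodClasses

/-! Lower elementary functions grow at most polynomially, so neither 2^k nor k! is available; the
proof must keep every quantity it computes polynomially bounded in the precision e.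

Analytically, ζ(s) = 1 + 1/(s-1) + g(s) with g entire. On O_e the point s stays at distance at least
1/e from 1, so replacing s by a nearby rational point costs at most a factor 2e² in 1/(s-1), which
is then an explicit fraction. The function g is expanded at an integer c ≥ r + 3 as Σ b_k (c-s)^k,
where b_k = Σ_{n≥2} (log n)^k / (k! n^c) - (c-1)^{-(k+1)} (`hasSum_zetaReg`). Cauchy estimates on a
larger circle bound the truncation error by M exp(-K) (`exists_norm_sum_zetaCoeff_sub_le`). Hence K
= log e + O(1) terms suffice, and for fixed R the powers R^K are polynomial in e
(`exists_lowElem_pow_le`).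

It remains to compute the terms uniformly in k and e. Logarithms of integers are approximated by
pieces of the harmonic series (`log_sub_sum_le`), and exp x by counting the integers whose logarithm
is at most x + log Q (`abs_exp_sub_card_le`). The count is a bounded sum as soon as exp x has a
lower elementary bound. Powers, binomial coefficients and (log n)^k / k! ≤ n are all obtained as
such exponentials of sums and products of logarithms. -/

namespace GoodClasses

/-! ### Lower elementary maps between coded types: arithmetic and bounded sums -/

/-- A type whose elements are coded by tuples of natural numbers of a fixed length. -/
class Coded (α : Type) where
  dim : ℕ
  code : α → Fin dim → ℕ

open Coded

instance instCodedNat : Coded ℕ := ⟨1, fun n _ => n⟩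

instance instCodedPi (n : ℕ) : Coded (Fin n → ℕ) := ⟨n, id⟩

instance instCodedProd {α β : Type} [Coded α] [Coded β] : Coded (α × β) :=
  ⟨dim α + dim β, fun p => Fin.append (code p.1) (code p.2)⟩

/-- A map between coded types is lower elementary if the components of the code of its value are
lower elementary functions of the code of its argument. -/
@[fun_prop]
def LowElem {α β : Type} [Coded α] [Coded β] (f : α → β) : Prop :=
  ∀ j, ∃ g ∈ lowerElementary (dim α), ∀ a, code (f a) j = g (code a)

section LowElem

variable {α β γ : Type} [Coded α] [Coded β] [Coded γ]

theorem lowElem_nat_iff {f : α → ℕ} :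
    LowElem f ↔ ∃ g ∈ lowerElementary (dim α), ∀ a, f a = g (code a) :=
  ⟨fun h => h 0, fun h _ => h⟩

@[fun_prop]
theorem LowElem.id : LowElem (fun a : α => a) := fun j =>
  ⟨fun v => v j, isGoodClass_lowerElementary.proj _ j, fun _ => rfl⟩

@[fun_prop]
theorem LowElem.const (b : β) : LowElem (fun _ : α => b) := fun j =>
  ⟨fun _ => code b j, isGoodClass_lowerElementary.const _ _, fun _ => rfl⟩

@[fun_prop]
theorem LowElem.comp {f : β → γ} {h : α → β} (hf : LowElem f) (hh : LowElem h) :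
    LowElem (fun a => f (h a)) := fun j => by
  obtain ⟨g, hg, hfg⟩ := hf j
  choose k hk hhk using hh
  refine ⟨_, isGoodClass_lowerElementary.comp _ _ g k hg hk, fun a => ?_⟩
  rw [hfg]
  congr 1
  funext i
  exact hhk i a

@[fun_prop]
theorem LowElem.prodMk {f : α → β} {g : α → γ} (hf : LowElem f) (hg : LowElem g) :
    LowElem (fun a => (f a, g a)) := by
  intro j
  refine Fin.addCases (fun i => ?_) (fun i => ?_) j
  · obtain ⟨k, hk, h⟩ := hf i
    exact ⟨k, hk, fun a => (Fin.append_left _ _ i).trans (h a)⟩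
  · obtain ⟨k, hk, h⟩ := hg i
    exact ⟨k, hk, fun a => (Fin.append_right _ _ i).trans (h a)⟩

theorem lowElem_fst : LowElem (fun p : α × β => p.1) := fun j =>
  ⟨fun v => v (Fin.castAdd (dim β) j), isGoodClass_lowerElementary.proj _ _,
    fun p => (Fin.append_left (code p.1) (code p.2) j).symm⟩

theorem lowElem_snd : LowElem (fun p : α × β => p.2) := fun j =>
  ⟨fun v => v (Fin.natAdd (dim α) j), isGoodClass_lowerElementary.proj _ _,
    fun p => (Fin.append_right (code p.1) (code p.2) j).symm⟩

@[fun_prop]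
theorem LowElem.fst {f : α → β × γ} (hf : LowElem f) : LowElem (fun a => (f a).1) :=
  lowElem_fst.comp hf

@[fun_prop]
theorem LowElem.snd {f : α → β × γ} (hf : LowElem f) : LowElem (fun a => (f a).2) :=
  lowElem_snd.comp hf

theorem lowElem_apply {n : ℕ} (i : Fin n) : LowElem (fun v : Fin n → ℕ => v i) := fun _ =>
  ⟨fun v => v i, isGoodClass_lowerElementary.proj _ _, fun _ => rfl⟩

theorem LowElem.apply {n : ℕ} {f : α → Fin n → ℕ} (hf : LowElem f) (i : Fin n) :
    LowElem (fun a => f a i) := (lowElem_apply i).comp hf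

theorem lowElem_pi {n : ℕ} {f : α → Fin n → ℕ} (hf : ∀ i, LowElem (fun a => f a i)) :
    LowElem f := fun j => hf j 0

@[fun_prop]
theorem LowElem.sub {f g : α → ℕ} (hf : LowElem f) (hg : LowElem g) :
    LowElem (fun a => f a - g a) := by
  have h : LowElem (fun v : Fin 2 → ℕ => v 0 - v 1) := fun _ =>
    ⟨_, isGoodClass_lowerElementary.sub, fun _ => rfl⟩
  have h2 : LowElem (fun a => ![f a, g a]) := lowElem_pi fun i => by fin_cases i <;> assumption
  exact h.comp h2

@[fun_prop]
theorem LowElem.succ {f : α → ℕ} (hf : LowElem f) : LowElem (fun a => f a + 1) := by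
  have h : LowElem (fun v : Fin 1 → ℕ => v 0 + 1) := fun _ =>
    ⟨_, isGoodClass_lowerElementary.succ, fun _ => rfl⟩
  exact h.comp (lowElem_pi fun _ => hf : LowElem (fun a => fun _ : Fin 1 => f a))

theorem LowElem.sum_range_succ {F : α × ℕ → ℕ} {b : α → ℕ} (hF : LowElem F) (hb : LowElem b) :
    LowElem (fun a => ∑ i ∈ Finset.range (b a + 1), F (a, i)) := by
  obtain ⟨g, hg, hFg⟩ := lowElem_nat_iff.1 hF
  have key := isGoodClass_lowerElementary.bsum (dim α) g hg
  have h : LowElem (fun p : α × ℕ => ∑ i ∈ Finset.range (p.2 + 1), F (p.1, i)) := by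
    refine lowElem_nat_iff.2 ⟨_, key, fun p => ?_⟩
    have h1 : code p (Fin.last (dim α)) = p.2 :=
      Fin.append_right (code p.1) (code p.2) (0 : Fin 1)
    rw [h1]
    refine Finset.sum_congr rfl fun i _ => ?_
    rw [hFg]
    congr 1
    funext j
    refine Fin.lastCases ?_ (fun j => ?_) j
    · rw [Function.update_self]
      exact Fin.append_right (code p.1) (code i) (0 : Fin 1)
    · rw [Function.update_of_ne (Fin.castSucc_lt_last j).ne]
      exact (Fin.append_left (code p.1) (code i) j).trans
        (Fin.append_left (code p.1) (code p.2) j).symm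
  exact h.comp (LowElem.id.prodMk hb)

@[fun_prop]
theorem LowElem.sum_range {F : α → ℕ → ℕ} {b : α → ℕ}
    (hF : LowElem (fun p : α × ℕ => F p.1 p.2)) (hb : LowElem b) :
    LowElem (fun a => ∑ i ∈ Finset.range (b a), F a i) := by
  -- The closure axiom sums up to and including b, so the last term is subtracted again.
  have h := (hF.sum_range_succ hb).sub (hF.comp (LowElem.id.prodMk hb))
  simpa only [Finset.sum_range_succ, Nat.add_sub_cancel] using h

@[fun_prop]
theorem LowElem.mul {f g : α → ℕ} (hf : LowElem f) (hg : LowElem g) :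
    LowElem (fun a => f a * g a) := by
  have h : LowElem (fun a => ∑ _i ∈ Finset.range (g a), f a) :=
    LowElem.sum_range (F := fun a _ => f a) (hf.comp lowElem_fst) hg
  simpa [mul_comm] using h

@[fun_prop]
-- Addition is not among the generators; it is recovered from products, as f + g = (f+1)(g+1) - fg -
-- 1.
theorem LowElem.add {f g : α → ℕ} (hf : LowElem f) (hg : LowElem g) :
    LowElem (fun a => f a + g a) := by
  have h : LowElem (fun a => (f a + 1) * (g a + 1) - f a * g a - 1) :=
    ((hf.succ.mul hg.succ).sub (hf.mul hg)).sub (LowElem.const 1)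
  have e : (fun a => (f a + 1) * (g a + 1) - f a * g a - 1) = fun a => f a + g a := by
    funext a
    have : (f a + 1) * (g a + 1) = f a * g a + (f a + g a + 1) := by ring
    omega
  rwa [e] at h

@[fun_prop]
theorem LowElem.pow {f : α → ℕ} (hf : LowElem f) (k : ℕ) : LowElem (fun a => f a ^ k) := by
  induction k with
  | zero => simpa using LowElem.const 1
  | succ k ih => simpa only [pow_succ] using ih.mul hf

/-! ### Lower elementary predicates, division and gcd -/

/-- A predicate is lower elementary if it is the positivity of a lower elementary function. -/
def LowElemPred (P : α → Prop) : Prop :=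
  ∃ χ : α → ℕ, LowElem χ ∧ ∀ a, P a ↔ 0 < χ a

theorem LowElem.lt {f g : α → ℕ} (hf : LowElem f) (hg : LowElem g) :
    LowElemPred (fun a => f a < g a) := ⟨_, hg.sub hf, fun a => by omega⟩

theorem LowElem.le {f g : α → ℕ} (hf : LowElem f) (hg : LowElem g) :
    LowElemPred (fun a => f a ≤ g a) := ⟨_, hg.succ.sub hf, fun a => by omega⟩

theorem LowElemPred.and {P Q : α → Prop} (hP : LowElemPred P) (hQ : LowElemPred Q) :
    LowElemPred (fun a => P a ∧ Q a) := by
  obtain ⟨χ, h, e⟩ := hP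
  obtain ⟨ψ, h', e'⟩ := hQ
  exact ⟨_, h.mul h', fun a => by simp only [e, e', Nat.pos_iff_ne_zero, mul_ne_zero_iff]⟩

theorem LowElem.eq {f g : α → ℕ} (hf : LowElem f) (hg : LowElem g) :
    LowElemPred (fun a => f a = g a) := by
  simpa only [le_antisymm_iff] using (hf.le hg).and (hg.le hf)

theorem LowElemPred.exists_lt {P : α → ℕ → Prop} {b : α → ℕ}
    (hP : LowElemPred (fun p : α × ℕ => P p.1 p.2)) (hb : LowElem b) :
    LowElemPred (fun a => ∃ i < b a, P a i) := by
  obtain ⟨χ, hχ, e⟩ := hP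
  refine ⟨fun a => ∑ i ∈ Finset.range (b a), χ (a, i), by fun_prop, fun a => ?_⟩
  simp only [fun i => e (a, i), Finset.sum_pos_iff, Finset.mem_range]

theorem LowElem.ite {P : α → Prop} [DecidablePred P] {f g : α → ℕ} (hP : LowElemPred P)
    (hf : LowElem f) (hg : LowElem g) : LowElem (fun a => if P a then f a else g a) := by
  obtain ⟨χ, hχ, e⟩ := hP
  have h : LowElem (fun a => (1 - (1 - χ a)) * f a + (1 - χ a) * g a) := by fun_prop
  convert h using 2 with a
  by_cases ha : P a
  · have := (e a).1 ha
    have h0 : 1 - χ a = 0 := by omega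
    simp [ha, h0]
  · have : χ a = 0 := by have := (e a).not.1 ha; omega
    simp [ha, this]

@[fun_prop]
theorem LowElem.div {f g : α → ℕ} (hf : LowElem f) (hg : LowElem g) :
    LowElem (fun a => f a / g a) := by
  -- The quotient f / g is the number of i < f with (i+1)g ≤ f.
  have h : LowElem (fun a => if 0 < g a then
      ∑ i ∈ Finset.range (f a), if (i + 1) * g a ≤ f a then 1 else 0 else 0) := by
    refine LowElem.ite ((LowElem.const 0).lt hg) ?_ (LowElem.const 0)
    refine LowElem.sum_range (F := fun a i => if (i + 1) * g a ≤ f a then 1 else 0) ?_ hf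
    exact LowElem.ite (LowElem.le (by fun_prop) (by fun_prop)) (by fun_prop) (by fun_prop)
  convert h using 2 with a
  split_ifs with h0
  · simp only [← Nat.le_div_iff_mul_le h0, Nat.succ_le_iff]
    rw [Finset.sum_ite, Finset.sum_const_zero, add_zero, Finset.sum_const, smul_eq_mul, mul_one]
    have : (Finset.range (f a)).filter (fun i => i < f a / g a) = Finset.range (f a / g a) := by
      ext i
      have := Nat.div_le_self (f a) (g a)
      simp only [Finset.mem_filter, Finset.mem_range]
      omega
    rw [this, Finset.card_range]
  · simp [Nat.eq_zero_of_not_pos h0]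

@[fun_prop]
theorem LowElem.mod {f g : α → ℕ} (hf : LowElem f) (hg : LowElem g) :
    LowElem (fun a => f a % g a) := by
  have h : LowElem (fun a => f a - g a * (f a / g a)) := by fun_prop
  convert h using 2 with a
  have := Nat.mod_add_div (f a) (g a)
  omega

theorem LowElem.dvd {f g : α → ℕ} (hf : LowElem f) (hg : LowElem g) :
    LowElemPred (fun a => f a ∣ g a) := by
  simpa only [Nat.dvd_iff_mod_eq_zero] using (hg.mod hf).eq (LowElem.const 0)

@[fun_prop]
theorem LowElem.gcd {f g : α → ℕ} (hf : LowElem f) (hg : LowElem g) :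
    LowElem (fun a => Nat.gcd (f a) (g a)) := by
  classical
  -- The gcd is the number of i < g for which some common divisor is at least i + 1; such a divisor
  -- is i + 1 + x with x < g - i.
  have h : LowElem (fun a => if 0 < g a then ∑ i ∈ Finset.range (g a),
      if ∃ x < g a - i, (i + 1 + x) ∣ f a ∧ (i + 1 + x) ∣ g a then 1 else 0 else f a) := by
    refine LowElem.ite ((LowElem.const 0).lt hg) ?_ hf
    refine LowElem.sum_range (F := fun a i =>
      if ∃ x < g a - i, (i + 1 + x) ∣ f a ∧ (i + 1 + x) ∣ g a then 1 else 0) ?_ hg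
    refine LowElem.ite ?_ (by fun_prop) (by fun_prop)
    refine LowElemPred.exists_lt
      (P := fun (p : α × ℕ) x => (p.2 + 1 + x) ∣ f p.1 ∧ (p.2 + 1 + x) ∣ g p.1) ?_ (by fun_prop)
    exact (LowElem.dvd (by fun_prop) (by fun_prop)).and (LowElem.dvd (by fun_prop) (by fun_prop))
  convert h using 2 with a
  split_ifs with h0
  · have key : ∀ i, (∃ x < g a - i, (i + 1 + x) ∣ f a ∧ (i + 1 + x) ∣ g a) ↔
        i < Nat.gcd (f a) (g a) := by
      refine fun i => ⟨?_, fun hi => ⟨Nat.gcd (f a) (g a) - (i + 1), ?_, ?_⟩⟩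
      · rintro ⟨x, -, h1, h2⟩
        have := Nat.le_of_dvd (Nat.gcd_pos_of_pos_right _ h0) (Nat.dvd_gcd h1 h2)
        omega
      · have := Nat.gcd_le_right (f a) h0
        omega
      · rw [show i + 1 + (Nat.gcd (f a) (g a) - (i + 1)) = Nat.gcd (f a) (g a) by omega]
        exact ⟨Nat.gcd_dvd_left _ _, Nat.gcd_dvd_right _ _⟩
    simp only [key]
    rw [Finset.sum_ite, Finset.sum_const_zero, add_zero, Finset.sum_const, smul_eq_mul, mul_one]
    have : (Finset.range (g a)).filter (fun i => i < Nat.gcd (f a) (g a)) =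
        Finset.range (Nat.gcd (f a) (g a)) := by
      ext i
      have := Nat.gcd_le_right (f a) h0
      simp only [Finset.mem_filter, Finset.mem_range]
      omega
    rw [this, Finset.card_range]
  · simp [Nat.eq_zero_of_not_pos h0]

/-- Passing to the reduced fraction is division by a gcd; the sum of the two truncated differences
is |v 0 - v 1|. -/
theorem rat_ι_π (v : Fin 3 → ℕ) : Retract.rat.ι (Retract.rat.π v) =
    if 0 < v 2 then
      ![(v 0 - v 1) / Nat.gcd (v 2) ((v 0 - v 1) + (v 1 - v 0)),
        (v 1 - v 0) / Nat.gcd (v 2) ((v 0 - v 1) + (v 1 - v 0)),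
        v 2 / Nat.gcd (v 2) ((v 0 - v 1) + (v 1 - v 0))]
    else ![0, 0, 1] := by
  split_ifs with h
  · have hπ : Retract.rat.π v = Rat.divInt ((v 0 : ℤ) - (v 1 : ℤ)) (v 2 : ℤ) := by
      rw [Rat.divInt_eq_div]
      simp only [Retract.rat, if_pos h, Int.cast_natCast]
    have hg : ((v 2 : ℕ) : ℤ).gcd ((v 0 : ℤ) - (v 1 : ℤ)) =
        Nat.gcd (v 2) ((v 0 - v 1) + (v 1 - v 0)) := by
      rw [Int.gcd, Int.natAbs_natCast]
      congr 1
      omega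
    have hnum : (Retract.rat.π v).num = ((v 0 : ℤ) - (v 1 : ℤ)) /
        (Nat.gcd (v 2) ((v 0 - v 1) + (v 1 - v 0)) : ℕ) := by
      rw [hπ, Rat.num_divInt, hg, Int.sign_natCast_of_ne_zero h.ne', one_mul]
    have hden : (Retract.rat.π v).den = v 2 / Nat.gcd (v 2) ((v 0 - v 1) + (v 1 - v 0)) := by
      rw [hπ, Rat.den_divInt, hg, if_neg (by exact_mod_cast h.ne'), Int.natAbs_natCast]
    have hd : (Nat.gcd (v 2) ((v 0 - v 1) + (v 1 - v 0)) : ℤ) ∣ (v 0 : ℤ) - (v 1 : ℤ) := by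
      rw [← hg]
      exact Int.gcd_dvd_right _ _
    change ![(max (Retract.rat.π v).num 0).toNat, (-min 0 (Retract.rat.π v).num).toNat,
      (Retract.rat.π v).den] = _
    rw [hden, hnum]
    have hpos : 0 < Nat.gcd (v 2) ((v 0 - v 1) + (v 1 - v 0)) := Nat.gcd_pos_of_pos_left _ h
    generalize Nat.gcd (v 2) ((v 0 - v 1) + (v 1 - v 0)) = g at hd hpos
    rcases le_total (v 1) (v 0) with h01 | h01
    · have e1 : (v 0 : ℤ) - (v 1 : ℤ) = ((v 0 - v 1 : ℕ) : ℤ) := by omega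
      rw [e1, ← Int.natCast_div, Nat.sub_eq_zero_of_le h01, Nat.zero_div]
      generalize (v 0 - v 1) / g = x
      have h1 : (max (x : ℤ) 0).toNat = x := by omega
      have h2 : (-min 0 (x : ℤ)).toNat = 0 := by omega
      rw [h1, h2]
    · obtain ⟨c, hc⟩ := hd
      have hc' : ((v 1 - v 0 : ℕ) : ℤ) = g * (-c) := by
        have := mul_neg (g : ℤ) c
        omega
      have hg0 : (g : ℤ) ≠ 0 := by exact_mod_cast hpos.ne'
      have e2 : (((v 1 - v 0) / g : ℕ) : ℤ) = -c := by
        rw [Int.natCast_div, hc', Int.mul_ediv_cancel_left _ hg0]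
      rw [hc, Int.mul_ediv_cancel_left _ hg0, Nat.sub_eq_zero_of_le h01, Nat.zero_div]
      generalize (v 1 - v 0) / g = x at e2
      have h1 : (max c 0).toNat = 0 := by omega
      have h2 : (-min 0 c).toNat = x := by omega
      rw [h1, h2]
  · simp [Retract.rat, h]

theorem LowElem.rat_ι_π {f : α → Fin 3 → ℕ} (hf : LowElem f) :
    LowElem (fun a => Retract.rat.ι (Retract.rat.π (f a))) := by
  have h0 := hf.apply 0
  have h1 := hf.apply 1
  have h2 := hf.apply 2
  simp only [GoodClasses.rat_ι_π]
  refine lowElem_pi fun i => ?_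
  fin_cases i
  · have : LowElem (fun a => if 0 < f a 2 then
        (f a 0 - f a 1) / Nat.gcd (f a 2) ((f a 0 - f a 1) + (f a 1 - f a 0)) else 0) :=
      LowElem.ite (LowElem.lt (by fun_prop) h2) (by fun_prop) (by fun_prop)
    convert this using 2 with a
    split_ifs <;> rfl
  · have : LowElem (fun a => if 0 < f a 2 then
        (f a 1 - f a 0) / Nat.gcd (f a 2) ((f a 0 - f a 1) + (f a 1 - f a 0)) else 0) :=
      LowElem.ite (LowElem.lt (by fun_prop) h2) (by fun_prop) (by fun_prop)
    convert this using 2 with a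
    split_ifs <;> rfl
  · have : LowElem (fun a => if 0 < f a 2 then
        f a 2 / Nat.gcd (f a 2) ((f a 0 - f a 1) + (f a 1 - f a 0)) else 1) :=
      LowElem.ite (LowElem.lt (by fun_prop) h2) (by fun_prop) (by fun_prop)
    convert this using 2 with a
    split_ifs <;> rfl

end LowElem

/-! ### Approximable real functions: field operations, limits and sums -/

/-- A real-valued function that is approximated with error `1 / (e + 1)` by a lower elementary
fraction `(p - m) / q` depending on the argument and on `e`. -/
def Approximable {α : Type} [Coded α] (F : α → ℝ) : Prop :=
  ∃ p m q : α × ℕ → ℕ, LowElem p ∧ LowElem m ∧ LowElem q ∧ ∀ a e, 0 < q (a, e) ∧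
    |F a - ((p (a, e) : ℝ) - m (a, e)) / q (a, e)| ≤ 1 / ((e : ℝ) + 1)

section Approximable

variable {α β : Type} [Coded α] [Coded β]

theorem natCast_div_bounds (x : ℕ) {y : ℕ} (hy : 0 < y) :
    (x : ℝ) / y - 1 ≤ ((x / y : ℕ) : ℝ) ∧ ((x / y : ℕ) : ℝ) ≤ (x : ℝ) / y := by
  refine ⟨?_, Nat.cast_div_le⟩
  have h : (x : ℝ) < y * ((x / y : ℕ) + 1) := by exact_mod_cast Nat.lt_mul_div_succ x hy
  have hy' : (0 : ℝ) < y := by exact_mod_cast hy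
  rw [sub_le_iff_le_add, div_le_iff₀ hy']
  linarith [mul_comm (y : ℝ) ((x / y : ℕ) + 1)]

/-- Rounding p and m separately to multiples of 1/(e+1) costs one more 1/(e+1). A prescribed
denominator makes approximations easy to add, sum and compare. -/
theorem Approximable.fixed {F : α → ℝ} (hF : Approximable F) :
    ∃ p m : α × ℕ → ℕ, LowElem p ∧ LowElem m ∧
      ∀ a e, |F a - ((p (a, e) : ℝ) - m (a, e)) / ((e : ℝ) + 1)| ≤ 2 / ((e : ℝ) + 1) := by
  obtain ⟨p, m, q, hp, hm, hq, h⟩ := hF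
  refine ⟨fun x => p x * (x.2 + 1) / q x, fun x => m x * (x.2 + 1) / q x, by fun_prop,
    by fun_prop, fun a e => ?_⟩
  obtain ⟨hq0, hF⟩ := h a e
  have hq0' : (0 : ℝ) < q (a, e) := by exact_mod_cast hq0
  have he : (0 : ℝ) < (e : ℝ) + 1 := by positivity
  have h1 := natCast_div_bounds (p (a, e) * (e + 1)) hq0
  have h2 := natCast_div_bounds (m (a, e) * (e + 1)) hq0
  push_cast at h1 h2 ⊢
  generalize ((p (a, e) * (e + 1) / q (a, e) : ℕ) : ℝ) = x at *
  generalize ((m (a, e) * (e + 1) / q (a, e) : ℕ) : ℝ) = y at *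
  have e1 : ((p (a, e) : ℝ) - m (a, e)) / q (a, e) =
      (p (a, e) * ((e : ℝ) + 1) / q (a, e) - m (a, e) * ((e : ℝ) + 1) / q (a, e)) /
        ((e : ℝ) + 1) := by field_simp
  rw [e1] at hF
  generalize (p (a, e) * ((e : ℝ) + 1) / q (a, e) : ℝ) = x' at *
  generalize (m (a, e) * ((e : ℝ) + 1) / q (a, e) : ℝ) = y' at *
  have h3 : |(x' - y') / ((e : ℝ) + 1) - (x - y) / ((e : ℝ) + 1)| ≤ 1 / ((e : ℝ) + 1) := by
    rw [← sub_div, abs_div, abs_of_pos he]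
    gcongr
    rw [abs_le]
    constructor <;> linarith
  calc _ ≤ _ := abs_sub_le _ ((x' - y') / ((e : ℝ) + 1)) _
    _ ≤ 1 / ((e : ℝ) + 1) + 1 / ((e : ℝ) + 1) := add_le_add hF h3
    _ = _ := by ring

theorem Approximable.comp {F : β → ℝ} {h : α → β} (hF : Approximable F) (hh : LowElem h) :
    Approximable (fun a => F (h a)) := by
  obtain ⟨p, m, q, hp, hm, hq, H⟩ := hF
  exact ⟨fun x => p (h x.1, x.2), fun x => m (h x.1, x.2), fun x => q (h x.1, x.2),
    by fun_prop, by fun_prop, by fun_prop, fun a e => H (h a) e⟩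

theorem LowElem.approximable {f : α → ℕ} (hf : LowElem f) :
    Approximable (fun a => (f a : ℝ)) :=
  ⟨fun x => f x.1, fun _ => 0, fun _ => 1, by fun_prop, by fun_prop, by fun_prop,
    fun a e => ⟨one_pos, by simp; positivity⟩⟩

theorem approximable_natCast (c : ℕ) : Approximable (fun _ : α => (c : ℝ)) :=
  (LowElem.const c).approximable

theorem LowElem.approximable_inv {f : α → ℕ} (hf : LowElem f) :
    Approximable (fun a => (f a : ℝ)⁻¹) := by
  refine ⟨fun x => if f x.1 = 0 then 0 else 1, fun _ => 0, fun x => if f x.1 = 0 then 1 else f x.1,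
    LowElem.ite (LowElem.eq (by fun_prop) (by fun_prop)) (by fun_prop) (by fun_prop), by fun_prop,
    LowElem.ite (LowElem.eq (by fun_prop) (by fun_prop)) (by fun_prop) (by fun_prop),
    fun a e => ?_⟩
  by_cases h : f a = 0
  · simp [h]; positivity
  · simp only [h, if_false]
    exact ⟨Nat.pos_of_ne_zero h, by simp; positivity⟩

theorem Approximable.of_limit {F : α → ℝ} {G : α × ℕ → ℝ} (hG : Approximable G)
    (h : ∀ a M, |F a - G (a, M)| ≤ 1 / ((M : ℝ) + 1)) : Approximable F := by
  obtain ⟨p, m, q, hp, hm, hq, H⟩ := hG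
  -- Index and precision 2e+1 make each of the two errors 1/(2(e+1)).
  refine ⟨fun x => p ((x.1, 2 * x.2 + 1), 2 * x.2 + 1), fun x => m ((x.1, 2 * x.2 + 1), 2 * x.2 + 1),
    fun x => q ((x.1, 2 * x.2 + 1), 2 * x.2 + 1), by fun_prop, by fun_prop, by fun_prop,
    fun a e => ?_⟩
  obtain ⟨h0, h1⟩ := H (a, 2 * e + 1) (2 * e + 1)
  refine ⟨h0, ?_⟩
  have h2 := h a (2 * e + 1)
  calc _ ≤ _ := abs_sub_le _ (G (a, 2 * e + 1)) _
    _ ≤ _ := add_le_add h2 h1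
    _ = _ := by push_cast; field_simp; ring

theorem Approximable.of_limit_mul {F : α → ℝ} {G : α × ℕ → ℝ} {C : α → ℕ} (hG : Approximable G)
    (hC : LowElem C) (h : ∀ a M, |F a - G (a, M)| ≤ C a / ((M : ℝ) + 1)) : Approximable F := by
  have hG' : Approximable (fun x : α × ℕ => G (x.1, C x.1 * (x.2 + 1))) :=
    hG.comp (h := fun x : α × ℕ => (x.1, C x.1 * (x.2 + 1))) (by fun_prop)
  refine hG'.of_limit fun a M => (h a _).trans ?_
  push_cast
  rw [div_le_div_iff₀ (by positivity) (by positivity)]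
  linarith

theorem Approximable.congr {F G : α → ℝ} (hF : Approximable F) (h : ∀ a, G a = F a) :
    Approximable G := by
  rwa [show G = F from funext h]

theorem Approximable.neg {F : α → ℝ} (hF : Approximable F) : Approximable (fun a => -F a) := by
  obtain ⟨p, m, q, hp, hm, hq, H⟩ := hF
  refine ⟨m, p, q, hm, hp, hq, fun a e => ⟨(H a e).1, ?_⟩⟩
  rw [← abs_neg]
  convert (H a e).2 using 2
  ring

theorem Approximable.add {F G : α → ℝ} (hF : Approximable F) (hG : Approximable G) :
    Approximable (fun a => F a + G a) := by
  obtain ⟨p, m, hp, hm, H⟩ := hF.fixed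
  obtain ⟨p', m', hp', hm', H'⟩ := hG.fixed
  refine ⟨fun x => p (x.1, 4 * x.2 + 3) + p' (x.1, 4 * x.2 + 3),
    fun x => m (x.1, 4 * x.2 + 3) + m' (x.1, 4 * x.2 + 3), fun x => 4 * x.2 + 3 + 1,
    by fun_prop, by fun_prop, by fun_prop, fun a e => ⟨Nat.succ_pos _, ?_⟩⟩
  have h1 := H a (4 * e + 3)
  have h2 := H' a (4 * e + 3)
  push_cast at *
  calc _ = |(F a - ((p (a, 4 * e + 3) : ℝ) - m (a, 4 * e + 3)) / (4 * (e : ℝ) + 3 + 1)) +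
        (G a - ((p' (a, 4 * e + 3) : ℝ) - m' (a, 4 * e + 3)) / (4 * (e : ℝ) + 3 + 1))| := by
        congr 1; ring
    _ ≤ _ := abs_add_le _ _
    _ ≤ _ := add_le_add h1 h2
    _ = _ := by field_simp; ring

theorem Approximable.sub {F G : α → ℝ} (hF : Approximable F) (hG : Approximable G) :
    Approximable (fun a => F a - G a) := by
  simpa only [sub_eq_add_neg] using hF.add hG.neg

/-- The approximation at precision 0 already bounds the function, so approximable functions never
outgrow the lower elementary ones. -/
theorem Approximable.exists_bound {F : α → ℝ} (hF : Approximable F) :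
    ∃ B : α → ℕ, LowElem B ∧ ∀ a, |F a| ≤ B a := by
  obtain ⟨p, m, hp, hm, H⟩ := hF.fixed
  refine ⟨fun a => p (a, 0) + m (a, 0) + 2, by fun_prop, fun a => ?_⟩
  have := H a 0
  simp only [CharP.cast_eq_zero, zero_add, div_one] at this
  rw [abs_le] at this ⊢
  push_cast
  have h1 : (0 : ℝ) ≤ p (a, 0) := by positivity
  have h2 : (0 : ℝ) ≤ m (a, 0) := by positivity
  constructor <;> linarith

theorem Approximable.mul {F G : α → ℝ} (hF : Approximable F) (hG : Approximable G) :
    Approximable (fun a => F a * G a) := by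
  obtain ⟨B, hB, hFB⟩ := hF.exists_bound
  obtain ⟨B', hB', hGB⟩ := hG.exists_bound
  obtain ⟨p, m, hp, hm, H⟩ := hF.fixed
  obtain ⟨p', m', hp', hm', H'⟩ := hG.fixed
  -- With both factors known up to 2/D, the product is off by at most B·2/D + (B'+2)·2/D; this
  -- precision makes that at most 1/(e+1).
  have hE : LowElem (fun x : α × ℕ => (x.1, 2 * (B x.1 + B' x.1 + 2) * (x.2 + 1))) := by fun_prop
  have k1 := hp.comp hE
  have k2 := hm.comp hE
  have k3 := hp'.comp hE
  have k4 := hm'.comp hE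
  refine ⟨_, _, _, (k1.mul k3).add (k2.mul k4), (k1.mul k4).add (k2.mul k3),
    (hE.snd.succ.mul hE.snd.succ), fun a e => ⟨by positivity, ?_⟩⟩
  have h1 := H a (2 * (B a + B' a + 2) * (e + 1))
  have h2 := H' a (2 * (B a + B' a + 2) * (e + 1))
  have h3 := hFB a
  have h4 := hGB a
  dsimp only
  push_cast at *
  set D : ℝ := 2 * ((B a : ℝ) + B' a + 2) * (e + 1) + 1 with hD
  have hD0 : 1 ≤ D := by rw [hD]; simp; positivity
  have e1 : ∀ x y z w : ℝ, (x * y + z * w - (x * w + z * y)) / (D * D) =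
      ((x - z) / D) * ((y - w) / D) := by intros; field_simp; ring
  rw [e1]
  generalize (((p (a, 2 * (B a + B' a + 2) * (e + 1)) : ℝ) -
    m (a, 2 * (B a + B' a + 2) * (e + 1))) / D) = X at *
  generalize (((p' (a, 2 * (B a + B' a + 2) * (e + 1)) : ℝ) -
    m' (a, 2 * (B a + B' a + 2) * (e + 1))) / D) = Y at *
  have h5 : |Y| ≤ B' a + 2 := by
    have h6 : 2 / D ≤ 2 := div_le_self (by norm_num) hD0
    have := abs_sub_abs_le_abs_sub Y (G a)
    rw [abs_sub_comm] at this
    linarith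
  calc |F a * G a - X * Y| = |F a * (G a - Y) + Y * (F a - X)| := by congr 1; ring
    _ ≤ |F a| * |G a - Y| + |Y| * |F a - X| := by
        rw [← abs_mul, ← abs_mul]; exact abs_add_le _ _
    _ ≤ B a * (2 / D) + (B' a + 2) * (2 / D) := by gcongr
    _ = 2 * ((B a : ℝ) + B' a + 2) / D := by ring
    _ ≤ _ := by
        rw [div_le_div_iff₀ (by linarith) (by positivity)]
        linarith

theorem Approximable.sum_range {F : α → ℕ → ℝ} {b : α → ℕ}
    (hF : Approximable (fun x : α × ℕ => F x.1 x.2)) (hb : LowElem b) :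
    Approximable (fun a => ∑ i ∈ Finset.range (b a), F a i) := by
  obtain ⟨p, m, hp, hm, H⟩ := hF.fixed
  have hE : LowElem (fun y : (α × ℕ) × ℕ => ((y.1.1, y.2), 2 * (b y.1.1 + 1) * (y.1.2 + 1))) := by
    fun_prop
  refine ⟨fun x => ∑ i ∈ Finset.range (b x.1), p ((x.1, i), 2 * (b x.1 + 1) * (x.2 + 1)),
    fun x => ∑ i ∈ Finset.range (b x.1), m ((x.1, i), 2 * (b x.1 + 1) * (x.2 + 1)),
    fun x => 2 * (b x.1 + 1) * (x.2 + 1) + 1, LowElem.sum_range (hp.comp hE) (by fun_prop),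
    LowElem.sum_range (hm.comp hE) (by fun_prop), by fun_prop, fun a e => ⟨by positivity, ?_⟩⟩
  have h : ∀ i, _ := fun i => H (a, i) (2 * (b a + 1) * (e + 1))
  push_cast at *
  rw [← Finset.sum_sub_distrib, Finset.sum_div, ← Finset.sum_sub_distrib]
  refine (Finset.abs_sum_le_sum_abs _ _).trans
    ((Finset.sum_le_sum fun i _ => h i).trans ?_)
  rw [Finset.sum_const, Finset.card_range, nsmul_eq_mul, ← mul_div_assoc,
    div_le_div_iff₀ (by positivity) (by positivity)]
  nlinarith [(by positivity : (0 : ℝ) ≤ e)]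

theorem Approximable.ite {P : α → Prop} [DecidablePred P] {F G : α → ℝ} (hP : LowElemPred P)
    (hF : Approximable F) (hG : Approximable G) :
    Approximable (fun a => if P a then F a else G a) := by
  have h1 : LowElem (fun a => if P a then 1 else 0) :=
    LowElem.ite hP (LowElem.const 1) (LowElem.const 0)
  have h2 : LowElem (fun a => if P a then 0 else 1) :=
    LowElem.ite hP (LowElem.const 0) (LowElem.const 1)
  refine ((h1.approximable.mul hF).add (h2.approximable.mul hG)).congr fun a => ?_
  split_ifs <;> simp

/-! ### Logarithm and exponential -/

/-- log n is the integral of 1/x from M to Mn, and the sum of 1/j over M < j ≤ Mn is its lower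
Riemann sum. The defect telescopes to at most 1/M. -/
theorem log_sub_sum_le (M n : ℕ) (hM : 0 < M) (hn : 0 < n) :
    |Real.log n - ∑ i ∈ Finset.range (M * n - M), ((M + 1 + i : ℕ) : ℝ)⁻¹| ≤ 1 / M := by
  have step : ∀ k : ℕ, 0 < k → ((k + 1 : ℕ) : ℝ)⁻¹ ≤ Real.log (k + 1 : ℕ) - Real.log k ∧
      Real.log (k + 1 : ℕ) - Real.log k ≤ (k : ℝ)⁻¹ := by
    intro k hk
    have hk' : (0 : ℝ) < k := by exact_mod_cast hk
    have hk1 : (0 : ℝ) < (k + 1 : ℕ) := by positivity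
    rw [← Real.log_div hk1.ne' hk'.ne']
    constructor
    · have := Real.one_sub_inv_le_log_of_pos (div_pos hk1 hk')
      refine le_trans (le_of_eq ?_) this
      push_cast
      field_simp
      ring
    · have := Real.log_le_sub_one_of_pos (div_pos hk1 hk')
      refine this.trans (le_of_eq ?_)
      push_cast
      field_simp
      ring
  have key : ∀ t : ℕ,
      ∑ i ∈ Finset.range t, ((M + 1 + i : ℕ) : ℝ)⁻¹ ≤ Real.log (M + t : ℕ) - Real.log M ∧
      Real.log (M + t : ℕ) - Real.log M ≤ ∑ i ∈ Finset.range t, ((M + 1 + i : ℕ) : ℝ)⁻¹ +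
        (M : ℝ)⁻¹ - ((M + t : ℕ) : ℝ)⁻¹ := by
    intro t
    induction t with
    | zero => simp
    | succ t ih =>
      obtain ⟨s1, s2⟩ := step (M + t) (by omega)
      rw [Finset.sum_range_succ, show M + 1 + t = M + t + 1 by ring,
        show M + (t + 1) = M + t + 1 by ring]
      constructor <;> linarith [ih.1, ih.2]
  obtain ⟨k1, k2⟩ := key (M * n - M)
  have hle : M ≤ M * n := Nat.le_mul_of_pos_right M hn
  have hM' : (0 : ℝ) < M := by exact_mod_cast hM
  have hn' : (0 : ℝ) < n := by exact_mod_cast hn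
  rw [show M + (M * n - M) = M * n by omega, Nat.cast_mul,
    Real.log_mul hM'.ne' hn'.ne'] at k1 k2
  have h0 : 0 ≤ ((M : ℝ) * n)⁻¹ := by positivity
  rw [abs_le, one_div]
  have h1 : 0 ≤ (M : ℝ)⁻¹ := by positivity
  constructor <;> linarith

theorem LowElem.approximable_log {f : α → ℕ} (hf : LowElem f) :
    Approximable (fun a => Real.log (f a)) := by
  have h : Approximable (fun x : α × ℕ => ∑ i ∈ Finset.range ((x.2 + 1) * f x.1 - (x.2 + 1)),
      ((x.2 + 1 + 1 + i : ℕ) : ℝ)⁻¹) :=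
    Approximable.sum_range
      (LowElem.approximable_inv (f := fun y : (α × ℕ) × ℕ => y.1.2 + 1 + 1 + y.2) (by fun_prop))
      (by fun_prop)
  refine h.of_limit fun a M => ?_
  rcases Nat.eq_zero_or_pos (f a) with h0 | h0
  -- For argument 0 both sides vanish: `Real.log 0 = 0`, and the truncated range is empty.
  · simp [h0]; positivity
  · have := log_sub_sum_le (M + 1) (f a) M.succ_pos h0
    push_cast at *
    exact this

theorem abs_log_sub_log_le {x y c : ℝ} (hc : 0 < c) (hx : c ≤ x) (hy : c ≤ y) :
    |Real.log x - Real.log y| ≤ |x - y| / c := by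
  have key : ∀ x y : ℝ, c ≤ x → c ≤ y → Real.log x - Real.log y ≤ |x - y| / c := by
    intro x y hx hy
    have hx0 := hc.trans_le hx
    have hy0 := hc.trans_le hy
    rw [← Real.log_div hx0.ne' hy0.ne']
    refine (Real.log_le_sub_one_of_pos (div_pos hx0 hy0)).trans ?_
    rw [div_sub_one hy0.ne']
    calc (x - y) / y ≤ |x - y| / y := by gcongr; exact le_abs_self _
      _ ≤ _ := by gcongr
  rw [abs_le]
  have h1 := key x y hx hy
  have h2 := key y x hy hx
  rw [abs_sub_comm] at h2
  constructor <;> linarith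

/-- The lower bound 1/B keeps the rational approximations above 1/(2B), where log has Lipschitz
constant 2B; the log of the fraction is then a difference of logs of integers. -/
theorem Approximable.log {F : α → ℝ} {B : α → ℕ} (hF : Approximable F) (hB : LowElem B)
    (hB0 : ∀ a, 0 < B a) (hFB : ∀ a, 1 / (B a : ℝ) ≤ F a) :
    Approximable (fun a => Real.log (F a)) := by
  obtain ⟨p, m, hp, hm, H⟩ := hF.fixed
  have hE : LowElem (fun x : α × ℕ => (x.1, 4 * B x.1 * (x.2 + 1))) := by fun_prop
  have k1 := hp.comp hE
  have k2 := hm.comp hE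
  refine ((k1.sub k2).approximable_log.sub hE.snd.succ.approximable_log).of_limit fun a M => ?_
  have h1 := H a (4 * B a * (M + 1))
  have hB1 : (1 : ℝ) ≤ B a := by exact_mod_cast hB0 a
  dsimp only
  set E : ℕ := 4 * B a * (M + 1) with hE
  have hEr : (E : ℝ) = 4 * B a * (M + 1) := by rw [hE]; push_cast; ring
  have hE1 : (0 : ℝ) < (E : ℝ) + 1 := by positivity
  have hsmall : 2 / ((E : ℝ) + 1) ≤ 1 / (2 * (B a : ℝ)) / (M + 1) := by
    rw [div_div, div_le_div_iff₀ hE1 (by positivity), hEr]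
    linarith
  have hsmall2 : 2 / ((E : ℝ) + 1) ≤ 1 / (2 * (B a : ℝ)) := by
    refine hsmall.trans (div_le_self (by positivity) ?_)
    linarith [(by positivity : (0 : ℝ) ≤ M)]
  have hhalf : 1 / (B a : ℝ) = 1 / (2 * (B a : ℝ)) + 1 / (2 * (B a : ℝ)) := by
    field_simp; norm_num
  have hc : 0 < 1 / (2 * (B a : ℝ)) := by positivity
  have hX : 1 / (2 * (B a : ℝ)) ≤ ((p (a, E) : ℝ) - m (a, E)) / ((E : ℝ) + 1) := by
    have := hFB a
    rw [abs_le] at h1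
    linarith [h1.2]
  have hpos : (0 : ℝ) < (p (a, E) : ℝ) - m (a, E) := by
    have := hc.trans_le hX
    rwa [div_pos_iff_of_pos_right hE1] at this
  have hmp : m (a, E) ≤ p (a, E) := by
    have : (m (a, E) : ℝ) ≤ p (a, E) := by linarith
    exact_mod_cast this
  rw [Nat.cast_sub hmp, Nat.cast_succ, ← Real.log_div hpos.ne' hE1.ne']
  have hF' : 1 / (2 * (B a : ℝ)) ≤ F a := by linarith [hFB a]
  refine (abs_log_sub_log_le hc hF' hX).trans ?_
  rw [div_le_iff₀ hc]
  calc _ ≤ _ := h1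
    _ ≤ _ := hsmall
    _ = _ := by ring

/-- Counting the integers whose approximate logarithm is at most `x + log Q` gives an
approximation of `Q * exp x`. -/
theorem abs_exp_sub_card_le {x δ : ℝ} {B Q : ℕ} (hQ : 0 < Q) (hδ : 0 ≤ δ) (hδ1 : δ ≤ 1)
    (hB : Real.exp x ≤ B) {S : Finset ℕ}
    (hin : ∀ i < B * Q, Real.log (i + 1 : ℕ) ≤ x + Real.log Q - δ → i ∈ S)
    (hout : ∀ i ∈ S, Real.log (i + 1 : ℕ) ≤ x + Real.log Q + δ) :
    |Real.exp x - (S.card : ℝ) / Q| ≤ B * (2 * δ) + 1 / Q := by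
  have hQ' : (0 : ℝ) < Q := by exact_mod_cast hQ
  have hexp : ∀ t : ℝ, |t| ≤ 1 → |Real.exp (x + t) - Real.exp x| ≤ B * (2 * |t|) := by
    intro t ht
    rw [Real.exp_add, ← mul_sub_one, abs_mul, abs_of_pos (Real.exp_pos x)]
    gcongr
    exact Real.abs_exp_sub_one_le ht
  have hup : (S.card : ℝ) ≤ Q * Real.exp (x + δ) := by
    have h1 : S ⊆ Finset.range ⌊Q * Real.exp (x + δ)⌋₊ := by
      intro i hi
      have h2 := hout i hi
      rw [Finset.mem_range, ← Nat.succ_le_iff, Nat.le_floor_iff (by positivity)]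
      rw [Real.log_le_iff_le_exp (by positivity), show x + Real.log Q + δ = Real.log Q + (x + δ) by
        ring, Real.exp_add, Real.exp_log hQ'] at h2
      exact h2
    have h2 := Finset.card_le_card h1
    rw [Finset.card_range] at h2
    exact (Nat.cast_le.2 h2).trans (Nat.floor_le (by positivity))
  have hlow : Q * Real.exp (x - δ) - 1 ≤ (S.card : ℝ) := by
    have h1 : Finset.range ⌊Q * Real.exp (x - δ)⌋₊ ⊆ S := by
      intro i hi
      rw [Finset.mem_range, ← Nat.succ_le_iff, Nat.le_floor_iff (by positivity)] at hi
      have h3 : Real.exp (x - δ) ≤ B := (Real.exp_le_exp.2 (by linarith)).trans hB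
      refine hin i ?_ ?_
      · have : ((i + 1 : ℕ) : ℝ) ≤ (B * Q : ℕ) := by
          push_cast at hi ⊢
          nlinarith
        exact Nat.lt_of_succ_le (by exact_mod_cast this)
      · rw [Real.log_le_iff_le_exp (by positivity),
          show x + Real.log Q - δ = Real.log Q + (x - δ) by ring, Real.exp_add, Real.exp_log hQ']
        exact hi
    have h2 := Finset.card_le_card h1
    rw [Finset.card_range] at h2
    have h3 := (Nat.sub_one_lt_floor (Q * Real.exp (x - δ))).le
    exact h3.trans (Nat.cast_le.2 h2)
  have e1 := hexp δ (by rwa [abs_of_nonneg hδ])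
  have e2 := hexp (-δ) (by rwa [abs_neg, abs_of_nonneg hδ])
  rw [abs_neg, abs_of_nonneg hδ, ← sub_eq_add_neg] at e2
  rw [abs_of_nonneg hδ] at e1
  have hup' : (S.card : ℝ) / Q ≤ Real.exp (x + δ) := by
    rw [div_le_iff₀ hQ']; linarith
  have hlow' : Real.exp (x - δ) - 1 / Q ≤ (S.card : ℝ) / Q := by
    rw [le_div_iff₀ hQ', sub_mul, one_div, inv_mul_cancel₀ hQ'.ne']; linarith
  have h0 : 0 ≤ 1 / (Q : ℝ) := by positivity
  rw [abs_le] at e1 e2 ⊢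
  constructor <;> linarith [e1.1, e1.2, e2.1, e2.2]

theorem Approximable.exp {F : α → ℝ} {B : α → ℕ} (hF : Approximable F) (hB : LowElem B)
    (hFB : ∀ a, Real.exp (F a) ≤ B a) : Approximable (fun a => Real.exp (F a)) := by
  have hD : Approximable (fun y : (α × ℕ) × ℕ =>
      F y.1.1 + Real.log (y.1.2 + 1 : ℕ) - Real.log (y.2 + 1 : ℕ)) :=
    ((hF.comp (h := fun y : (α × ℕ) × ℕ => y.1.1) (by fun_prop)).add
      (LowElem.approximable_log (f := fun y : (α × ℕ) × ℕ => y.1.2 + 1) (by fun_prop))).sub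
      (LowElem.approximable_log (f := fun y : (α × ℕ) × ℕ => y.2 + 1) (by fun_prop))
  obtain ⟨p, m, hp, hm, H⟩ := hD.fixed
  have hE : LowElem (fun y : (α × ℕ) × ℕ => (y, 4 * (B y.1.1 + 1) * (y.1.2 + 1))) := by fun_prop
  -- The test m ≤ p decides, up to the error 2/(E+1), whether log(i+1) ≤ F + log Q with Q = x.2 + 1;
  -- the bound B limits the search to i < BQ.
  have hN : LowElem (fun x : α × ℕ => ∑ i ∈ Finset.range (B x.1 * (x.2 + 1)),
      if m ((x, i), 4 * (B x.1 + 1) * (x.2 + 1)) ≤ p ((x, i), 4 * (B x.1 + 1) * (x.2 + 1))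
      then 1 else 0) := by
    refine LowElem.sum_range (F := fun (x : α × ℕ) i =>
      if m ((x, i), 4 * (B x.1 + 1) * (x.2 + 1)) ≤ p ((x, i), 4 * (B x.1 + 1) * (x.2 + 1))
      then 1 else 0) ?_ (by fun_prop)
    exact LowElem.ite ((hm.comp hE).le (hp.comp hE)) (by fun_prop) (by fun_prop)
  refine (hN.approximable.mul (LowElem.approximable_inv (f := fun x : α × ℕ => x.2 + 1)
    (by fun_prop))).of_limit_mul (C := fun _ => 2) (by fun_prop) fun a M => ?_
  dsimp only
  rw [← Finset.card_filter, ← div_eq_mul_inv]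
  have hM : (0 : ℝ) < (M : ℝ) + 1 := by positivity
  set E : ℕ := 4 * (B a + 1) * (M + 1) with hEdef
  have hEr : (E : ℝ) + 1 = 4 * (B a + 1) * (M + 1) + 1 := by rw [hEdef]; push_cast; ring
  have hpos : (0 : ℝ) < (E : ℝ) + 1 := by positivity
  have hδ1 : 2 / ((E : ℝ) + 1) ≤ 1 := by
    rw [div_le_one hpos, hEr]
    nlinarith [(by positivity : (0 : ℝ) ≤ (M : ℝ)), (by positivity : (0 : ℝ) ≤ (B a : ℝ)),
      (by positivity : (0 : ℝ) ≤ (B a : ℝ) * M)]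
  refine (abs_exp_sub_card_le (δ := 2 / ((E : ℝ) + 1)) M.succ_pos (by positivity) hδ1 (hFB a)
    ?_ ?_).trans ?_
  · intro i hi hlog
    rw [Finset.mem_filter, Finset.mem_range]
    refine ⟨hi, ?_⟩
    have h1 := H ((a, M), i) E
    dsimp only at h1
    rw [abs_le] at h1
    have h2 : 0 ≤ ((p (((a, M), i), E) : ℝ) - m (((a, M), i), E)) / ((E : ℝ) + 1) := by
      linarith [h1.2]
    have h3 : (0 : ℝ) ≤ (p (((a, M), i), E) : ℝ) - m (((a, M), i), E) := by
      rw [le_div_iff₀ hpos] at h2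
      linarith
    have : (m (((a, M), i), E) : ℝ) ≤ p (((a, M), i), E) := by linarith
    exact_mod_cast this
  · intro i hi
    rw [Finset.mem_filter] at hi
    have h1 := H ((a, M), i) E
    dsimp only at h1
    rw [abs_le] at h1
    have h3 : (m (((a, M), i), E) : ℝ) ≤ p (((a, M), i), E) := by exact_mod_cast hi.2
    have h2 : 0 ≤ ((p (((a, M), i), E) : ℝ) - m (((a, M), i), E)) / ((E : ℝ) + 1) :=
      div_nonneg (by linarith) hpos.le
    linarith [h1.1]
  · push_cast
    have : (B a : ℝ) * (2 * (2 / ((E : ℝ) + 1))) ≤ 1 / ((M : ℝ) + 1) := by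
      rw [show (B a : ℝ) * (2 * (2 / ((E : ℝ) + 1))) = 4 * B a / ((E : ℝ) + 1) by ring,
        div_le_div_iff₀ hpos hM, hEr]
      nlinarith [(by positivity : (0 : ℝ) ≤ (M : ℝ))]
    calc _ ≤ 1 / ((M : ℝ) + 1) + 1 / ((M : ℝ) + 1) := by gcongr
      _ = _ := by ring

end Approximable

/-! ### Powers, binomial coefficients and logarithmic powers as bounded exponentials -/

section Approximable

variable {α : Type} [Coded α]

/-- The bound is needed only where P holds, because the exponent is replaced by 0 elsewhere. -/
theorem Approximable.exp_of_pred {P : α → Prop} [DecidablePred P] {F : α → ℝ} {B : α → ℕ}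
    (hP : LowElemPred P) (hF : Approximable F) (hB : LowElem B)
    (hFB : ∀ a, P a → Real.exp (F a) ≤ B a) :
    Approximable (fun a => if P a then Real.exp (F a) else 0) := by
  have h0 : Approximable (fun _ : α => (0 : ℝ)) := by simpa using approximable_natCast (α := α) 0
  have h1 : Approximable (fun a => Real.exp (if P a then F a else 0)) := by
    refine (Approximable.ite hP hF h0).exp (B := fun a => B a + 1) (by fun_prop) fun a => ?_
    push_cast
    split_ifs with h
    · linarith [hFB a h]
    · simp
  refine (Approximable.ite hP h1 h0).congr fun a => ?_
  split_ifs <;> simp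

theorem Approximable.pow_div_of_pred {P : α → Prop} [DecidablePred P] {p q k B : α → ℕ}
    (hP : LowElemPred P) (hp : LowElem p) (hq : LowElem q) (hk : LowElem k) (hB : LowElem B)
    (h : ∀ a, P a → 0 < q a ∧ ((p a : ℝ) / q a) ^ k a ≤ B a) :
    Approximable (fun a => if P a then ((p a : ℝ) / q a) ^ k a else 0) := by
  have h0 : Approximable (fun _ : α => (0 : ℝ)) := by simpa using approximable_natCast (α := α) 0
  have hone : Approximable (fun _ : α => (1 : ℝ)) := by
    simpa using approximable_natCast (α := α) 1
  have e : ∀ a, 0 < q a → 0 < p a →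
      Real.exp (k a * (Real.log (p a) - Real.log (q a))) = ((p a : ℝ) / q a) ^ k a := by
    intro a hq hp
    have hq' : (0 : ℝ) < q a := by exact_mod_cast hq
    have hp' : (0 : ℝ) < p a := by exact_mod_cast hp
    rw [← Real.log_div hp'.ne' hq'.ne', Real.exp_nat_mul, Real.exp_log (by positivity)]
  have h1 := Approximable.exp_of_pred (P := fun a => P a ∧ 0 < p a)
    (hP.and ((LowElem.const 0).lt hp))
    (hk.approximable.mul (hp.approximable_log.sub hq.approximable_log)) hB
    fun a ⟨ha, hp0⟩ => by rw [e a (h a ha).1 hp0]; exact (h a ha).2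
  -- The exponential formula misses p = 0, where the only nonzero value is 0^0 = 1.
  have h2 := Approximable.ite (P := fun a => (P a ∧ p a = 0) ∧ k a = 0)
    ((hP.and (hp.eq (LowElem.const 0))).and (hk.eq (LowElem.const 0))) hone h0
  refine (h1.add h2).congr fun a => ?_
  by_cases ha : P a
  · rcases Nat.eq_zero_or_pos (p a) with hp0 | hp0
    · by_cases hk0 : k a = 0 <;> simp [ha, hp0, hk0]
    · simp [ha, hp0, hp0.ne', e a (h a ha).1 hp0]
  · simp [ha]

/-- The factorial grows too fast, but its logarithm is a bounded sum of logarithms. -/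
theorem approximable_log_factorial : Approximable (fun k : ℕ => Real.log (k.factorial)) := by
  have h : Approximable (fun k : ℕ => ∑ i ∈ Finset.range k, Real.log (i + 1 : ℕ)) :=
    Approximable.sum_range (F := fun _ i => Real.log (i + 1 : ℕ))
      (LowElem.approximable_log (f := fun x : ℕ × ℕ => x.2 + 1) (by fun_prop)) (by fun_prop)
  refine h.congr fun k => ?_
  rw [← Finset.prod_range_add_one_eq_factorial, Nat.cast_prod, Real.log_prod]
  intro i _
  positivity

theorem Approximable.choose_of_pred {P : α → Prop} [DecidablePred P] {k j B : α → ℕ}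
    (hP : LowElemPred P) (hk : LowElem k) (hj : LowElem j) (hB : LowElem B)
    (h : ∀ a, P a → j a ≤ k a ∧ (2 : ℝ) ^ k a ≤ B a) :
    Approximable (fun a => if P a then ((k a).choose (j a) : ℝ) else 0) := by
  have e : ∀ a, j a ≤ k a → Real.exp (Real.log ((k a).factorial) -
      Real.log ((j a).factorial) - Real.log ((k a - j a).factorial)) = (k a).choose (j a) := by
    intro a ha
    rw [Real.exp_sub, Real.exp_sub, Real.exp_log (by positivity), Real.exp_log (by positivity),
      Real.exp_log (by positivity), Nat.cast_choose ℝ ha, div_div]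
  have h1 := Approximable.exp_of_pred hP
    (((approximable_log_factorial.comp hk).sub (approximable_log_factorial.comp hj)).sub
      (approximable_log_factorial.comp (hk.sub hj))) hB fun a ha => by
        rw [e a (h a ha).1]
        refine le_trans ?_ (h a ha).2
        exact_mod_cast Nat.choose_le_two_pow _ _
  refine h1.congr fun a => ?_
  split_ifs with ha
  · exact (e a (h a ha).1).symm
  · rfl

/-- Written as exp(k log log n - log k!); the inequality t^k / k! ≤ exp t gives the bound n for all
k at once. Starting at n = 2 keeps log n above 1/2, so that log log n is approximable. -/
theorem approximable_log_pow_div_factorial : Approximable (fun x : ℕ × ℕ =>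
    Real.log (x.2 + 2 : ℕ) ^ x.1 / x.1.factorial) := by
  have hlog : ∀ n : ℕ, 1 / ((2 : ℕ) : ℝ) ≤ Real.log (n + 2 : ℕ) := by
    intro n
    have h1 : Real.log 2 ≤ Real.log (n + 2 : ℕ) := by
      apply Real.log_le_log (by norm_num)
      push_cast
      linarith [(by positivity : (0 : ℝ) ≤ n)]
    have := Real.log_two_gt_d9
    push_cast at *
    linarith
  have h1 : Approximable (fun x : ℕ × ℕ => Real.log (x.2 + 2 : ℕ)) :=
    LowElem.approximable_log (f := fun x : ℕ × ℕ => x.2 + 2) (by fun_prop)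
  have h2 : Approximable (fun x : ℕ × ℕ => Real.log (Real.log (x.2 + 2 : ℕ))) :=
    h1.log (B := fun _ => 2) (by fun_prop) (fun _ => two_pos) fun x => hlog x.2
  have h3 : Approximable (fun x : ℕ × ℕ =>
      (x.1 : ℝ) * Real.log (Real.log (x.2 + 2 : ℕ)) - Real.log (x.1.factorial)) :=
    ((lowElem_fst.approximable).mul h2).sub (approximable_log_factorial.comp lowElem_fst)
  have e : ∀ x : ℕ × ℕ, Real.log (x.2 + 2 : ℕ) ^ x.1 / x.1.factorial =
      Real.exp ((x.1 : ℝ) * Real.log (Real.log (x.2 + 2 : ℕ)) - Real.log (x.1.factorial)) := by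
    intro x
    have h0 : 0 < Real.log (x.2 + 2 : ℕ) := lt_of_lt_of_le (by norm_num) (hlog x.2)
    rw [Real.exp_sub, Real.exp_nat_mul, Real.exp_log h0, Real.exp_log (by positivity)]
  refine (h3.exp (B := fun x => x.2 + 2) (by fun_prop) fun x => ?_).congr e
  rw [← e]
  refine (Real.pow_div_factorial_le_exp _ (le_trans (by norm_num) (hlog x.2)) _).trans ?_
  rw [Real.exp_log (by positivity)]

/-! ### The Taylor coefficients of the entire part of zeta -/

/-- The coefficients of the expansion of `ζ(s) - 1 - 1 / (s - 1)` in powers of `c - s`. -/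
noncomputable def zetaCoeff (c k : ℕ) : ℝ :=
  ∑' n : ℕ, Real.log (n + 2 : ℕ) ^ k / k.factorial * (((n + 2) ^ c : ℕ) : ℝ)⁻¹ -
    (((c - 1 : ℕ) : ℝ) ^ (k + 1))⁻¹

theorem hasSum_telescope_tail (N : ℕ) :
    HasSum (fun n : ℕ => (((n + N : ℕ) : ℝ) + 1)⁻¹ - (((n + N : ℕ) : ℝ) + 2)⁻¹)
      (((N : ℝ) + 1)⁻¹) := by
  rw [hasSum_iff_tendsto_nat_of_nonneg]
  · have e : ∀ n : ℕ, ∑ i ∈ Finset.range n,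
        ((((i + N : ℕ) : ℝ) + 1)⁻¹ - (((i + N : ℕ) : ℝ) + 2)⁻¹) =
        ((N : ℝ) + 1)⁻¹ - (((n + N : ℕ) : ℝ) + 1)⁻¹ := by
      intro n
      induction n with
      | zero => simp
      | succ n ih =>
        rw [Finset.sum_range_succ, ih]
        push_cast
        ring
    simp only [e]
    have : Filter.Tendsto (fun n : ℕ => (((n + N : ℕ) : ℝ) + 1)⁻¹) Filter.atTop (nhds 0) := by
      have h := (tendsto_one_div_add_atTop_nhds_zero_nat (𝕜 := ℝ)).comp
        (Filter.tendsto_add_atTop_nat N)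
      simpa [Function.comp_def] using h
    simpa using this.const_sub (((N : ℝ) + 1)⁻¹)
  · intro i
    rw [sub_nonneg]
    gcongr
    norm_num

/-- One factor n + 2 absorbs the logarithmic power, and c ≥ 3 leaves 1/(n+2)². The telescoping
majorant does not depend on k, and its tail from N is exactly the 1/(N+1) asked for by
`Approximable.of_limit`. -/
theorem log_pow_mul_inv_le {c : ℕ} (hc : 3 ≤ c) (k n : ℕ) :
    Real.log (n + 2 : ℕ) ^ k / k.factorial * (((n + 2) ^ c : ℕ) : ℝ)⁻¹ ≤
      ((n : ℝ) + 1)⁻¹ - ((n : ℝ) + 2)⁻¹ := by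
  have h1 : Real.log (n + 2 : ℕ) ^ k / k.factorial ≤ (n : ℝ) + 2 := by
    refine (Real.pow_div_factorial_le_exp _ (Real.log_natCast_nonneg _) _).trans ?_
    rw [Real.exp_log (by positivity)]
    push_cast
    rfl
  have h2 : ((n : ℝ) + 2) ^ 3 ≤ (((n + 2) ^ c : ℕ) : ℝ) := by
    push_cast
    exact pow_le_pow_right₀ (by linarith [(by positivity : (0 : ℝ) ≤ n)]) hc
  calc _ ≤ ((n : ℝ) + 2) * (((n : ℝ) + 2) ^ 3)⁻¹ := by gcongr
    _ = ((n : ℝ) + 2)⁻¹ * ((n : ℝ) + 2)⁻¹ := by field_simp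
    _ ≤ ((n : ℝ) + 1)⁻¹ * ((n : ℝ) + 2)⁻¹ := by gcongr; norm_num
    _ = _ := by field_simp; ring

theorem log_pow_mul_inv_nonneg (c k n : ℕ) :
    0 ≤ Real.log (n + 2 : ℕ) ^ k / k.factorial * (((n + 2) ^ c : ℕ) : ℝ)⁻¹ := by
  have := Real.log_natCast_nonneg (n + 2)
  positivity

theorem summable_log_pow_mul_inv {c : ℕ} (hc : 3 ≤ c) (k : ℕ) :
    Summable fun n : ℕ => Real.log (n + 2 : ℕ) ^ k / k.factorial * (((n + 2) ^ c : ℕ) : ℝ)⁻¹ :=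
  Summable.of_nonneg_of_le (log_pow_mul_inv_nonneg c k) (log_pow_mul_inv_le hc k)
    (by simpa using (hasSum_telescope_tail 0).summable)

theorem approximable_zetaCoeff {c : ℕ} (hc : 3 ≤ c) : Approximable (zetaCoeff c) := by
  have h1 : Approximable (fun x : ℕ × ℕ =>
      ∑ n ∈ Finset.range x.2, Real.log (n + 2 : ℕ) ^ x.1 / x.1.factorial *
        (((n + 2) ^ c : ℕ) : ℝ)⁻¹) := by
    refine Approximable.sum_range (F := fun (x : ℕ × ℕ) n => Real.log (n + 2 : ℕ) ^ x.1 /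
      x.1.factorial * (((n + 2) ^ c : ℕ) : ℝ)⁻¹) ?_ (by fun_prop)
    exact (approximable_log_pow_div_factorial.comp
      (h := fun y : (ℕ × ℕ) × ℕ => (y.1.1, y.2)) (by fun_prop)).mul
      (LowElem.approximable_inv (f := fun y : (ℕ × ℕ) × ℕ => (y.2 + 2) ^ c) (by fun_prop))
  have h2 : Approximable (fun k : ℕ => ∑' n : ℕ, Real.log (n + 2 : ℕ) ^ k / k.factorial *
      (((n + 2) ^ c : ℕ) : ℝ)⁻¹) := by
    refine h1.of_limit fun k N => ?_
    have hs := summable_log_pow_mul_inv hc k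
    rw [← hs.sum_add_tsum_nat_add N, add_sub_cancel_left, abs_of_nonneg
      (tsum_nonneg fun n => log_pow_mul_inv_nonneg c k (n + N)), one_div]
    exact hasSum_le (fun n => log_pow_mul_inv_le hc k (n + N))
      ((summable_nat_add_iff N).2 hs).hasSum (hasSum_telescope_tail N)
  have h3 : Approximable (fun k : ℕ => if True then (((1 : ℕ) : ℝ) / ((c - 1 : ℕ) : ℝ)) ^ (k + 1)
      else 0) := by
    refine Approximable.pow_div_of_pred (B := fun _ => 1)
      ⟨fun _ => 1, LowElem.const 1, fun _ => by simp⟩ (LowElem.const 1) (LowElem.const _)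
      (by fun_prop) (by fun_prop) fun k _ => ⟨by omega, ?_⟩
    have h2 : (1 : ℝ) ≤ ((c - 1 : ℕ) : ℝ) := by
      exact_mod_cast (by omega : 1 ≤ c - 1)
    rw [Nat.cast_one]
    exact pow_le_one₀ (by positivity) (by rw [div_le_one (by linarith)]; exact h2)
  refine (h2.sub h3).congr fun k => ?_
  simp [zetaCoeff]

/-! ### Complex polynomials of logarithmic degree -/

theorem I_pow_eq (n : ℕ) : Complex.I ^ n =
    (((if n % 4 = 0 then 1 else 0) - (if n % 4 = 2 then 1 else 0) : ℝ) : ℂ) +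
    (((if n % 4 = 1 then 1 else 0) - (if n % 4 = 3 then 1 else 0) : ℝ) : ℂ) * Complex.I := by
  rw [Complex.I_pow_eq_pow_mod]
  have := Nat.mod_lt n (by norm_num : 0 < 4)
  generalize n % 4 = m at *
  interval_cases m <;> simp [Complex.I_sq, Complex.I_pow_three]

theorem LowElem.approximable_mod_sub_mod {f : α → ℕ} (hf : LowElem f) (i j : ℕ) :
    Approximable (fun a => (if f a % 4 = i then 1 else 0) - (if f a % 4 = j then 1 else 0)) := by
  have h : ∀ i : ℕ, Approximable (fun a => if f a % 4 = i then (1 : ℝ) else 0) := fun i => by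
    have := LowElem.approximable (LowElem.ite (P := fun a => f a % 4 = i)
      (LowElem.eq (by fun_prop) (by fun_prop)) (LowElem.const 1) (LowElem.const 0))
    simpa using this
  exact (h i).sub (h j)

/-- The binomial theorem splits each power into real and imaginary parts according to the exponent
of I mod 4; the odd power I^(2s+1) = ±I carries a sign. Each binomial coefficient and each power of
a fraction is at most R^K ≤ B, so it is approximable. -/
theorem exists_approximable_sum_pow {b : ℕ → ℝ} (hb : Approximable b) {R : ℕ} (hR : 2 ≤ R)
    {p q p' q' s K B : α → ℕ} (hp : LowElem p) (hq : LowElem q) (hp' : LowElem p')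
    (hq' : LowElem q') (hs : LowElem s) (hK : LowElem K) (hB : LowElem B)
    (hKB : ∀ a, (R : ℝ) ^ K a ≤ B a) :
    ∃ G H : α → ℝ, Approximable G ∧ Approximable H ∧ ∀ a, 0 < q a → 0 < q' a →
      p a ≤ R * q a → p' a ≤ R * q' a →
      ∑ k ∈ Finset.range (K a), (b k : ℂ) *
        ((p a / q a : ℝ) + (p' a / q' a : ℝ) * Complex.I ^ (2 * s a + 1)) ^ k =
        G a + H a * Complex.I := by
  classical
  -- Approximability is required for all arguments, including meaningless codes, so every factor is
  -- set to 0 outside the range where its bound holds.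
  let P : (α × ℕ) × ℕ → Prop := fun y => (((y.2 ≤ y.1.2 ∧ y.1.2 < K y.1.1) ∧
    (0 < q y.1.1 ∧ 0 < q' y.1.1)) ∧ (p y.1.1 ≤ R * q y.1.1 ∧ p' y.1.1 ≤ R * q' y.1.1))
  have hP : LowElemPred P :=
    ((LowElem.le (by fun_prop) (by fun_prop)).and (LowElem.lt (by fun_prop) (by fun_prop))).and
      ((LowElem.lt (by fun_prop) (by fun_prop)).and (LowElem.lt (by fun_prop) (by fun_prop))) |>.and
      ((LowElem.le (by fun_prop) (by fun_prop)).and (LowElem.le (by fun_prop) (by fun_prop)))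
  have hR1 : (1 : ℝ) ≤ R := by exact_mod_cast (by omega : 1 ≤ R)
  have bound : ∀ (a : α) (x y i : ℕ), 0 < y → x ≤ R * y → i ≤ K a →
      ((x : ℝ) / y) ^ i ≤ B a := by
    intro a x y i hy hxy hi
    have hy' : (0 : ℝ) < y := by exact_mod_cast hy
    have h1 : (x : ℝ) / y ≤ R := by
      rw [div_le_iff₀ hy']
      exact_mod_cast hxy
    calc ((x : ℝ) / y) ^ i ≤ (R : ℝ) ^ i := by gcongr
      _ ≤ (R : ℝ) ^ K a := pow_le_pow_right₀ hR1 hi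
      _ ≤ _ := hKB a
  have t1 : Approximable (fun y : (α × ℕ) × ℕ => if P y then (y.1.2.choose y.2 : ℝ) else 0) := by
    refine Approximable.choose_of_pred (B := fun y => B y.1.1) hP (by fun_prop) (by fun_prop)
      (by fun_prop) fun y hy => ⟨hy.1.1.1, ?_⟩
    calc (2 : ℝ) ^ y.1.2 ≤ (R : ℝ) ^ y.1.2 := by gcongr; exact_mod_cast hR
      _ ≤ (R : ℝ) ^ K y.1.1 := pow_le_pow_right₀ hR1 hy.1.1.2.le
      _ ≤ _ := hKB _
  have t2 : Approximable (fun y : (α × ℕ) × ℕ =>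
      if P y then ((p y.1.1 : ℝ) / q y.1.1) ^ (y.1.2 - y.2) else 0) :=
    Approximable.pow_div_of_pred (B := fun y => B y.1.1) hP (by fun_prop) (by fun_prop)
      (by fun_prop) (by fun_prop) fun y hy => ⟨hy.1.2.1, bound _ _ _ _ hy.1.2.1 hy.2.1
        ((Nat.sub_le _ _).trans hy.1.1.2.le)⟩
  have t3 : Approximable (fun y : (α × ℕ) × ℕ =>
      if P y then ((p' y.1.1 : ℝ) / q' y.1.1) ^ y.2 else 0) :=
    Approximable.pow_div_of_pred (B := fun y => B y.1.1) hP (by fun_prop) (by fun_prop)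
      (by fun_prop) (by fun_prop) fun y hy => ⟨hy.1.2.2, bound _ _ _ _ hy.1.2.2 hy.2.2
        (hy.1.1.1.trans hy.1.1.2.le)⟩
  let T : (α × ℕ) × ℕ → ℝ := fun y => b y.1.2 * ((if P y then (y.1.2.choose y.2 : ℝ) else 0) *
    ((if P y then ((p y.1.1 : ℝ) / q y.1.1) ^ (y.1.2 - y.2) else 0) *
      (if P y then ((p' y.1.1 : ℝ) / q' y.1.1) ^ y.2 else 0)))
  have hT : Approximable T :=
    (hb.comp (h := fun y : (α × ℕ) × ℕ => y.1.2) (by fun_prop)).mul (t1.mul (t2.mul t3))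
  have hsum : ∀ i j : ℕ, Approximable (fun a => ∑ k ∈ Finset.range (K a),
      ∑ l ∈ Finset.range (k + 1), T ((a, k), l) *
        ((if ((2 * s a + 1) * l) % 4 = i then 1 else 0) -
          (if ((2 * s a + 1) * l) % 4 = j then 1 else 0))) := by
    intro i j
    refine Approximable.sum_range (F := fun a k => ∑ l ∈ Finset.range (k + 1), T ((a, k), l) *
        ((if ((2 * s a + 1) * l) % 4 = i then 1 else 0) -
          (if ((2 * s a + 1) * l) % 4 = j then 1 else 0))) ?_ hK
    refine Approximable.sum_range (F := fun (x : α × ℕ) l => T (x, l) *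
        ((if ((2 * s x.1 + 1) * l) % 4 = i then 1 else 0) -
          (if ((2 * s x.1 + 1) * l) % 4 = j then 1 else 0))) ?_ (by fun_prop)
    exact hT.mul (LowElem.approximable_mod_sub_mod
      (f := fun y : (α × ℕ) × ℕ => (2 * s y.1.1 + 1) * y.2) (by fun_prop) i j)
  refine ⟨_, _, hsum 0 2, hsum 1 3, fun a h1 h2 h3 h4 => ?_⟩
  rw [Complex.ofReal_sum, Complex.ofReal_sum, Finset.sum_mul, ← Finset.sum_add_distrib]
  refine Finset.sum_congr rfl fun k hk => ?_
  rw [Complex.ofReal_sum, Complex.ofReal_sum, Finset.sum_mul, ← Finset.sum_add_distrib,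
    add_comm ((p a / q a : ℝ) : ℂ), add_pow, Finset.mul_sum]
  refine Finset.sum_congr rfl fun l hl => ?_
  have hPy : P ((a, k), l) := ⟨⟨⟨Nat.lt_succ_iff.1 (Finset.mem_range.1 hl),
    Finset.mem_range.1 hk⟩, h1, h2⟩, h3, h4⟩
  simp only [T, if_pos hPy]
  rw [mul_pow, ← pow_mul, I_pow_eq]
  push_cast
  ring

theorem exists_lowElem_log_le : ∃ K : ℕ → ℕ, LowElem K ∧
    ∀ e : ℕ, Real.log (e + 1 : ℕ) ≤ K e ∧ (K e : ℝ) ≤ Real.log (e + 1 : ℕ) + 4 := by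
  obtain ⟨p, m, hp, hm, H⟩ :=
    (LowElem.approximable_log (f := fun e : ℕ => e + 1) (by fun_prop)).fixed
  -- At precision 0 the error is at most 2; adding 2 gives an upper bound for the logarithm.
  refine ⟨fun e => p (e, 0) - m (e, 0) + 2, by fun_prop, fun e => ?_⟩
  have h1 := H e 0
  have h0 := Real.log_natCast_nonneg (e + 1)
  simp only [CharP.cast_eq_zero, zero_add, div_one] at h1
  rw [abs_le] at h1
  dsimp only
  rcases le_total (m (e, 0)) (p (e, 0)) with h | h
  · rw [Nat.cast_add (p (e, 0) - m (e, 0)), Nat.cast_sub h]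
    push_cast at *
    constructor <;> linarith [h1.1, h1.2]
  · rw [Nat.sub_eq_zero_of_le h]
    have h' : (p (e, 0) : ℝ) ≤ m (e, 0) := by exact_mod_cast h
    push_cast at *
    constructor <;> linarith [h1.1, h1.2]

/-- Since R ≤ exp R, the power R^K is at most exp(R(log(e+1) + 4)), a polynomial in e of degree R.
This is why logarithmically many terms are affordable. -/
theorem exists_lowElem_pow_le (R : ℕ) {K : ℕ → ℕ}
    (hK : ∀ e : ℕ, (K e : ℝ) ≤ Real.log (e + 1 : ℕ) + 4) :
    ∃ B : ℕ → ℕ, LowElem B ∧ ∀ e, (R : ℝ) ^ K e ≤ B e := by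
  refine ⟨fun e => (e + 1) ^ R * (3 ^ 4) ^ R, by fun_prop, fun e => ?_⟩
  have h1 : (R : ℝ) ≤ Real.exp R := by linarith [Real.add_one_le_exp (R : ℝ)]
  calc (R : ℝ) ^ K e ≤ Real.exp R ^ K e := by gcongr
    _ = Real.exp (R * K e) := by rw [← Real.exp_nat_mul, mul_comm]
    _ ≤ Real.exp (R * (Real.log (e + 1 : ℕ) + 4)) := by gcongr; exact hK e
    _ = (Real.exp (Real.log (e + 1 : ℕ))) ^ R * (Real.exp 1 ^ 4) ^ R := by
        rw [← Real.exp_nat_mul, ← Real.exp_nat_mul, ← Real.exp_nat_mul, ← Real.exp_add]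
        congr 1
        push_cast
        ring
    _ ≤ _ := by
        rw [Real.exp_log (by positivity)]
        rw [Nat.cast_mul, Nat.cast_pow, Nat.cast_pow, Nat.cast_pow]
        gcongr
        exact_mod_cast Real.exp_one_lt_three.le

end Approximable

/-! ### Complex analysis of the entire part of zeta -/

/-- The entire function `ζ(s) - 1 - 1 / (s - 1)`. -/
noncomputable def zetaReg (s : ℂ) : ℂ :=
  Function.update (fun s => riemannZeta s - 1 / (s - 1)) 1 (Real.eulerMascheroniConstant : ℂ) s - 1

theorem zetaReg_of_ne {s : ℂ} (hs : s ≠ 1) :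
    zetaReg s = riemannZeta s - 1 - (s - 1)⁻¹ := by
  rw [zetaReg, Function.update_of_ne hs, one_div]
  ring

/-- The singularity at 1 is removable: the value put there, γ - 1, is the limit. -/
theorem differentiable_zetaReg : Differentiable ℂ zetaReg := by
  have hne : ∀ s : ℂ, s ≠ 1 → DifferentiableAt ℂ zetaReg s := by
    intro s hs
    have h : zetaReg =ᶠ[nhds s] fun s => riemannZeta s - 1 - (s - 1)⁻¹ := by
      filter_upwards [isOpen_ne.mem_nhds hs] with z hz using zetaReg_of_ne hz
    refine DifferentiableAt.congr_of_eventuallyEq ?_ h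
    exact ((differentiableAt_riemannZeta hs).sub_const 1).sub
      ((differentiableAt_id.sub_const 1).inv (sub_ne_zero.2 hs))
  intro s
  rcases eq_or_ne s 1 with rfl | hs
  · refine (Complex.analyticAt_of_differentiable_on_punctured_nhds_of_continuousAt
      ?_ ?_).differentiableAt
    · filter_upwards [self_mem_nhdsWithin] with z hz using hne z hz
    · exact (continuousAt_update_same.2 tendsto_riemannZeta_sub_one_div).sub continuousAt_const
  · exact hne s hs

theorem logMul_iterate_one (k n : ℕ) :
    (LSeries.logMul^[k] 1) n = (Complex.log n) ^ k := by
  induction k with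
  | zero => simp
  | succ k ih =>
    rw [Function.iterate_succ_apply', LSeries.logMul, ih, pow_succ']

/-- Termwise differentiation of the Dirichlet series. Subtracting 1 removes the term n = 1, which
contributes only for k = 0. -/
theorem iteratedDeriv_zeta {c : ℕ} (hc : 3 ≤ c) (k : ℕ) :
    iteratedDeriv k (fun s => LSeries 1 s - 1) (c : ℂ) =
      (-1) ^ k * k.factorial * ((∑' n : ℕ, Real.log (n + 2 : ℕ) ^ k / k.factorial *
        (((n + 2) ^ c : ℕ) : ℝ)⁻¹ : ℝ) : ℂ) := by
  have hre : LSeries.abscissaOfAbsConv 1 < ((c : ℂ).re : EReal) := by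
    rw [LSeries.abscissaOfAbsConv_one, Complex.natCast_re]
    exact_mod_cast (by omega : 1 < c)
  have han := LSeries_analyticOnNhd 1 (c : ℂ) hre
  rw [iteratedDeriv_fun_sub han.contDiffAt contDiffAt_const, iteratedDeriv_const,
    LSeries_iteratedDeriv k hre]
  have hsum : Summable (LSeries.term (LSeries.logMul^[k] 1) (c : ℂ)) :=
    LSeriesSummable_of_abscissaOfAbsConv_lt_re (by rwa [LSeries.absicssaOfAbsConv_logPowMul])
  have hterm : ∀ n : ℕ, LSeries.term (LSeries.logMul^[k] 1) (c : ℂ) (n + 2) =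
      k.factorial * ((Real.log (n + 2 : ℕ) ^ k / k.factorial *
        (((n + 2) ^ c : ℕ) : ℝ)⁻¹ : ℝ) : ℂ) := by
    intro n
    have hk : (k.factorial : ℂ) ≠ 0 := by exact_mod_cast k.factorial_ne_zero
    rw [LSeries.term_of_ne_zero (by omega), logMul_iterate_one, Complex.cpow_natCast,
      ← Complex.natCast_log, Complex.ofReal_mul, Complex.ofReal_div, Complex.ofReal_pow,
      Complex.ofReal_inv, Complex.ofReal_natCast, Complex.ofReal_natCast, Nat.cast_pow]
    field_simp
  have h1 : LSeries.term (LSeries.logMul^[k] 1) (c : ℂ) 1 = if k = 0 then 1 else 0 := by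
    rw [LSeries.term_of_ne_zero one_ne_zero, logMul_iterate_one, Nat.cast_one, Complex.log_one,
      Complex.one_cpow, div_one, zero_pow_eq]
  have h2 : LSeries (LSeries.logMul^[k] 1) (c : ℂ) = (if k = 0 then 1 else 0) +
      k.factorial * ((∑' n : ℕ, Real.log (n + 2 : ℕ) ^ k / k.factorial *
        (((n + 2) ^ c : ℕ) : ℝ)⁻¹ : ℝ) : ℂ) := by
    rw [LSeries, ← hsum.sum_add_tsum_nat_add 2, Complex.ofReal_tsum, ← tsum_mul_left]
    simp only [hterm]
    rw [Finset.sum_range_succ, Finset.sum_range_one, LSeries.term_zero, zero_add, h1]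
  rw [h2]
  rcases eq_or_ne k 0 with rfl | hk
  · simp
  · simp only [hk, if_false]
    ring

theorem iteratedDeriv_zetaReg {c : ℕ} (hc : 3 ≤ c) (k : ℕ) :
    iteratedDeriv k zetaReg (c : ℂ) = (-1) ^ k * k.factorial * (zetaCoeff c k : ℂ) := by
  have hre : LSeries.abscissaOfAbsConv 1 < ((c : ℂ).re : EReal) := by
    rw [LSeries.abscissaOfAbsConv_one, Complex.natCast_re]
    exact_mod_cast (by omega : 1 < c)
  have han := LSeries_analyticOnNhd 1 (c : ℂ) hre
  have hc1 : (c : ℂ) - 1 ≠ 0 := by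
    rw [sub_ne_zero]
    exact_mod_cast (by omega : c ≠ 1)
  have hev : zetaReg =ᶠ[nhds (c : ℂ)] fun s => (LSeries 1 s - 1) - (s - 1)⁻¹ := by
    have : {s : ℂ | 1 < s.re} ∈ nhds (c : ℂ) :=
      (isOpen_lt continuous_const Complex.continuous_re).mem_nhds (by
        simp only [Set.mem_ofPred_eq, Complex.natCast_re]
        exact_mod_cast (by omega : 1 < c))
    filter_upwards [this] with s hs
    have hs1 : s ≠ 1 := by
      rintro rfl
      simp at hs
    rw [zetaReg_of_ne hs1, LSeries_one_eq_riemannZeta hs]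
  have hinv : ContDiffAt ℂ k (fun s : ℂ => (s - 1)⁻¹) (c : ℂ) :=
    (contDiffAt_id.sub contDiffAt_const).inv hc1
  have hd : iteratedDeriv k (fun s : ℂ => (s - 1)⁻¹) (c : ℂ) =
      (-1) ^ k * k.factorial * (((c : ℂ) - 1) ^ (k + 1))⁻¹ := by
    have h := congrFun (iteratedDeriv_comp_sub_const k (Inv.inv : ℂ → ℂ) 1) (c : ℂ)
    rw [h, iteratedDeriv_eq_iterate, iter_deriv_inv]
    congr 1
    rw [← zpow_natCast, ← zpow_neg]
    congr 1
    push_cast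
    ring
  rw [hev.iteratedDeriv_eq, iteratedDeriv_fun_sub (han.contDiffAt.sub contDiffAt_const) hinv,
    iteratedDeriv_zeta hc, hd, zetaCoeff, Complex.ofReal_sub]
  push_cast [Nat.cast_sub (by omega : 1 ≤ c)]
  ring

theorem hasSum_zetaReg {c : ℕ} (hc : 3 ≤ c) (z : ℂ) :
    HasSum (fun k => (zetaCoeff c k : ℂ) * ((c : ℂ) - z) ^ k) (zetaReg z) := by
  have h := Complex.hasSum_taylorSeries_of_entire differentiable_zetaReg (c : ℂ) z
  have e : (fun k => (zetaCoeff c k : ℂ) * ((c : ℂ) - z) ^ k) = fun k : ℕ =>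
      (k.factorial : ℂ)⁻¹ • (z - (c : ℂ)) ^ k • iteratedDeriv k zetaReg (c : ℂ) := by
    funext k
    have hk : (k.factorial : ℂ) ≠ 0 := by exact_mod_cast k.factorial_ne_zero
    rw [iteratedDeriv_zetaReg hc, smul_eq_mul, smul_eq_mul, ← neg_sub z (c : ℂ), neg_pow]
    field_simp
  rwa [e]

/-- Cauchy estimates on the circle of radius 3R dominate the series on radius R by a geometric one
of ratio 1/3, and 1/3 < exp(-1). -/
theorem exists_norm_sum_zetaCoeff_sub_le {c : ℕ} (hc : 3 ≤ c) {R : ℝ} (hR : 0 < R) :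
    ∃ M : ℝ, 0 < M ∧ ∀ z : ℂ, ‖(c : ℂ) - z‖ ≤ R → ∀ K : ℕ,
      ‖∑ k ∈ Finset.range K, (zetaCoeff c k : ℂ) * ((c : ℂ) - z) ^ k - zetaReg z‖ ≤
        M * Real.exp (-K) := by
  obtain ⟨C, hC⟩ := (isCompact_sphere (c : ℂ) (3 * R)).exists_bound_of_continuousOn
    differentiable_zetaReg.continuous.continuousOn
  have hC' : ∀ z ∈ Metric.sphere (c : ℂ) (3 * R), ‖zetaReg z‖ ≤ |C| + 1 := fun z hz =>
    (hC z hz).trans (by linarith [le_abs_self C])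
  have hb : ∀ k, ‖(zetaCoeff c k : ℂ)‖ ≤ (|C| + 1) / (3 * R) ^ k := by
    intro k
    have h := Complex.norm_iteratedDeriv_le_of_forall_mem_sphere_norm_le k (by positivity)
      differentiable_zetaReg.diffContOnCl hC'
    have hk : (0 : ℝ) < k.factorial := by positivity
    rw [iteratedDeriv_zetaReg hc, norm_mul, norm_mul, norm_pow, norm_neg, norm_one, one_pow,
      one_mul, Complex.norm_natCast, mul_div_assoc] at h
    exact le_of_mul_le_mul_left h hk
  refine ⟨(|C| + 1) * 2, by positivity, fun z hz K => ?_⟩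
  have h1 : ∀ k, ‖(zetaCoeff c k : ℂ) * ((c : ℂ) - z) ^ k‖ ≤ (|C| + 1) * (1 / 3 : ℝ) ^ k := by
    intro k
    rw [norm_mul, norm_pow]
    calc _ ≤ (|C| + 1) / (3 * R) ^ k * R ^ k := by gcongr; exact hb k
      _ = _ := by rw [mul_pow, div_pow, one_pow]; field_simp
  refine (norm_sub_le_of_geometric_bound_of_hasSum (by norm_num) h1 (hasSum_zetaReg hc z) K).trans ?_
  have h3 : (1 / 3 : ℝ) ^ K ≤ Real.exp (-K) := by
    rw [Real.exp_neg, one_div, inv_pow]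
    have : Real.exp K ≤ 3 ^ K := by
      rw [← mul_one (K : ℝ), Real.exp_nat_mul]
      exact pow_le_pow_left₀ (Real.exp_pos _).le Real.exp_one_lt_three.le K
    gcongr
  calc _ = (|C| + 1) * (3 / 2) * (1 / 3 : ℝ) ^ K := by ring
    _ ≤ (|C| + 1) * 2 * Real.exp (-K) := by gcongr; norm_num

theorem exists_lipschitz_zetaReg (R : ℝ) : ∃ L : ℝ, 0 < L ∧ ∀ z ∈ Metric.closedBall (1 : ℂ) R,
    ∀ w ∈ Metric.closedBall (1 : ℂ) R, ‖zetaReg z - zetaReg w‖ ≤ L * ‖z - w‖ := by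
  obtain ⟨C, hC⟩ := (isCompact_closedBall (1 : ℂ) R).exists_bound_of_continuousOn
    (differentiable_zetaReg.contDiff (n := 1)).continuous_deriv_one.continuousOn
  refine ⟨|C| + 1, by positivity, fun z hz w hw => ?_⟩
  exact (convex_closedBall (1 : ℂ) R).norm_image_sub_le_of_norm_deriv_le
    (fun x _ => differentiable_zetaReg x)
    (fun x hx => (hC x hx).trans (by linarith [le_abs_self C])) hw hz

/-! ### From approximations on codes to functions of rational arguments -/

theorem LowElem.mem_lowerElementary {n : ℕ} {f : (Fin n → ℕ) → ℕ} (hf : LowElem f) :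
    f ∈ lowerElementary n := by
  obtain ⟨g, hg, h⟩ := lowElem_nat_iff.1 hf
  have e : f = g := funext h
  rwa [e]

/-- The code of a rational number. -/
def ratCode (q : ℚ) : Fin 3 → ℕ := Retract.rat.ι q

theorem functionIn_of_approximable {O : Set (Fin 2 → ℝ)} {F : (Fin 2 → ℝ) → (Fin 2 → ℝ)}
    {d : ℕ → ℕ} (hd : StrictMono d) (hd' : LowElem d)
    {H : Fin 2 → ((Fin 3 → ℕ) × (Fin 3 → ℕ)) × ℕ → ℝ} (hH : ∀ j, Approximable (H j))
    (h : ∀ e : ℕ, 0 < e → ∀ a : Fin 2 → ℚ, ∀ x ∈ innerPart O e,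
      dist x (fun i => (a i : ℝ)) < 1 / (d e : ℝ) →
      ∀ j, |F x j - H j ((ratCode (a 0), ratCode (a 1)), e)| ≤ 1 / (2 * (e : ℝ))) :
    FunctionIn lowerElementary O F := by
  choose p m hp hm hpm using fun j => (hH j).fixed
  -- Precision 4e gives the error 2/(4e+1) < 1/(2e), the half of the budget left by the hypothesis.
  let E : ((Fin 3 → ℕ) × (Fin 3 → ℕ)) × ℕ → (((Fin 3 → ℕ) × (Fin 3 → ℕ)) × ℕ) × ℕ :=
    fun x => (x, 4 * x.2)
  have hE : LowElem E := by fun_prop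
  let g : Fin 2 → ((Fin 3 → ℕ) × (Fin 3 → ℕ)) × ℕ → Fin 3 → ℕ :=
    fun j x => ![p j (E x), m j (E x), 4 * x.2 + 1]
  have hg : ∀ j, LowElem (g j) := fun j => lowElem_pi fun i => by
    fin_cases i
    · exact (hp j).comp hE
    · exact (hm j).comp hE
    · exact (by fun_prop : LowElem fun x : ((Fin 3 → ℕ) × (Fin 3 → ℕ)) × ℕ => 4 * x.2 + 1)
  refine ⟨d, fun x j => Retract.rat.π (g j ((ratCode (x.1 0), ratCode (x.1 1)), x.2)),
    hd, fun _ => ?_, fun k => ?_, fun e he a x hx hxa => ?_⟩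
  · exact (hd'.comp (lowElem_apply (n := 1) 0)).mem_lowerElementary
  -- An input consists of 7 = 2·3 + 1 numbers; its fractions may be unreduced and are reduced first.
  · have hcode : ∀ i : Fin 2, LowElem (fun v : Fin 7 → ℕ => ratCode (Retract.rat.π
        (fun l : Fin 3 => v (Fin.castAdd 1 (finProdFinEquiv (i, l)))))) := fun i =>
      LowElem.rat_ι_π (f := fun v : Fin 7 → ℕ => fun l : Fin 3 =>
        v (Fin.castAdd 1 (finProdFinEquiv (i, l)))) (lowElem_pi fun _ => lowElem_apply _)
    have h1 := (hg (finProdFinEquiv.symm k).1).comp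
      (((hcode 0).prodMk (hcode 1)).prodMk (lowElem_apply (n := 7) (Fin.natAdd 6 (0 : Fin 1))))
    exact (h1.rat_ι_π.apply (finProdFinEquiv.symm k).2).mem_lowerElementary
  · rw [dist_pi_lt_iff (by positivity)]
    intro j
    have h1 := h e he a x hx hxa j
    have h2 := hpm j ((ratCode (a 0), ratCode (a 1)), e) (4 * e)
    have h3 : ((Retract.rat.π (g j ((ratCode (a 0), ratCode (a 1)), e)) : ℚ) : ℝ) =
        ((p j (((ratCode (a 0), ratCode (a 1)), e), 4 * e) : ℝ) -
          m j (((ratCode (a 0), ratCode (a 1)), e), 4 * e)) /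
          (((4 * e : ℕ) : ℝ) + 1) := by
      simp [Retract.rat, g, E]
    rw [Real.dist_eq, h3]
    refine (abs_sub_le _ _ _).trans_lt ((add_le_add h1 h2).trans_lt ?_)
    have he' : (0 : ℝ) < e := by exact_mod_cast he
    have h4 : 2 / (((4 * e : ℕ) : ℝ) + 1) < 1 / (2 * (e : ℝ)) := by
      push_cast
      rw [div_lt_div_iff₀ (by positivity) (by positivity)]
      linarith
    calc _ < 1 / (2 * (e : ℝ)) + 1 / (2 * (e : ℝ)) := by gcongr
      _ = _ := by field_simp; norm_num

theorem rat_ι_spec (q : ℚ) : 0 < ratCode q 2 ∧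
    ((ratCode q 0 : ℝ) - ratCode q 1) / ratCode q 2 = q ∧
    (ratCode q 0 = 0 ∨ ratCode q 1 = 0) := by
  have h0 : ratCode q 0 = (max q.num 0).toNat := rfl
  have h1 : ratCode q 1 = (-min 0 q.num).toNat := rfl
  have h2 : ratCode q 2 = q.den := rfl
  refine ⟨q.den_pos, ?_, by omega⟩
  have h : (ratCode q 0 : ℤ) - ratCode q 1 = q.num := by omega
  have h' : (ratCode q 0 : ℝ) - ratCode q 1 = q.num := by exact_mod_cast h
  rw [h', h2]
  exact_mod_cast Rat.num_div_den q

/-- Clearing denominators turns the inverse into integer polynomials over one natural number. That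
number may be 0, at the point 1, where both inverses are 0 by convention. -/
theorem exists_approximable_inv_sub_one :
    ∃ G H : (Fin 3 → ℕ) × (Fin 3 → ℕ) → ℝ, Approximable G ∧ Approximable H ∧
      ∀ s t : Fin 3 → ℕ, 0 < s 2 → 0 < t 2 →
        ((⟨((s 0 : ℝ) - s 1) / s 2, ((t 0 : ℝ) - t 1) / t 2⟩ : ℂ) - 1)⁻¹ =
          G (s, t) + H (s, t) * Complex.I := by
  have hs : ∀ i : Fin 3, LowElem (fun x : (Fin 3 → ℕ) × (Fin 3 → ℕ) => x.1 i) := fun i =>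
    LowElem.apply (by fun_prop) i
  have ht : ∀ i : Fin 3, LowElem (fun x : (Fin 3 → ℕ) × (Fin 3 → ℕ) => x.2 i) := fun i =>
    LowElem.apply (by fun_prop) i
  have hD : LowElem (fun x : (Fin 3 → ℕ) × (Fin 3 → ℕ) =>
      ((x.1 0 - (x.1 1 + x.1 2)) + ((x.1 1 + x.1 2) - x.1 0)) ^ 2 * x.2 2 ^ 2 +
        ((x.2 0 - x.2 1) + (x.2 1 - x.2 0)) ^ 2 * x.1 2 ^ 2) :=
    ((((hs 0).sub ((hs 1).add (hs 2))).add (((hs 1).add (hs 2)).sub (hs 0))).pow 2 |>.mul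
      ((ht 2).pow 2)).add ((((ht 0).sub (ht 1)).add ((ht 1).sub (ht 0))).pow 2 |>.mul ((hs 2).pow 2))
  have hN0 := ((hs 0).approximable.sub (hs 1).approximable).sub (hs 2).approximable
  have hN1 := (ht 0).approximable.sub (ht 1).approximable
  refine ⟨_, _, (hN0.mul ((hs 2).mul ((ht 2).pow 2)).approximable).mul hD.approximable_inv,
    ((hN1.neg).mul ((ht 2).mul ((hs 2).pow 2)).approximable).mul hD.approximable_inv,
    fun s t h1 h2 => ?_⟩
  have sq : ∀ x y : ℕ, ((((x - y) + (y - x)) ^ 2 : ℕ) : ℝ) = ((x : ℝ) - y) ^ 2 := by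
    intro x y
    rcases le_total x y with h | h
    · rw [Nat.sub_eq_zero_of_le h, zero_add, Nat.cast_pow, Nat.cast_sub h]; ring
    · rw [Nat.sub_eq_zero_of_le h, add_zero, Nat.cast_pow, Nat.cast_sub h]
  have h1' : (0 : ℝ) < s 2 := by exact_mod_cast h1
  have h2' : (0 : ℝ) < t 2 := by exact_mod_cast h2
  dsimp only
  have hcast : (((((s 0 - (s 1 + s 2)) + ((s 1 + s 2) - s 0)) ^ 2 * t 2 ^ 2 +
      ((t 0 - t 1) + (t 1 - t 0)) ^ 2 * s 2 ^ 2 : ℕ)) : ℝ) =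
      ((s 0 : ℝ) - s 1 - s 2) ^ 2 * t 2 ^ 2 + ((t 0 : ℝ) - t 1) ^ 2 * s 2 ^ 2 := by
    rw [Nat.cast_add, Nat.cast_mul, Nat.cast_mul, sq, sq]
    push_cast
    ring
  rw [hcast]
  have key : ∀ N0 N1 A B : ℝ, 0 < A → 0 < B →
      (⟨N0 / A, N1 / B⟩ : ℂ)⁻¹ = ⟨N0 * (A * B ^ 2) * (N0 ^ 2 * B ^ 2 + N1 ^ 2 * A ^ 2)⁻¹,
        -N1 * (B * A ^ 2) * (N0 ^ 2 * B ^ 2 + N1 ^ 2 * A ^ 2)⁻¹⟩ := by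
    intro N0 N1 A B hA hB
    have e : Complex.normSq ⟨N0 / A, N1 / B⟩ =
        (N0 ^ 2 * B ^ 2 + N1 ^ 2 * A ^ 2) * ((A * B) ^ 2)⁻¹ := by
      rw [Complex.normSq_mk]
      field_simp
    apply Complex.ext
    · rw [Complex.inv_re, e, div_eq_mul_inv, mul_inv, inv_inv]
      field_simp
    · rw [Complex.inv_im, e, div_eq_mul_inv, mul_inv, inv_inv]
      field_simp
  have e0 : ((⟨((s 0 : ℝ) - s 1) / s 2, ((t 0 : ℝ) - t 1) / t 2⟩ : ℂ) - 1) =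
      ⟨(s 0 - s 1 - s 2) / s 2, ((t 0 : ℝ) - t 1) / t 2⟩ := by
    apply Complex.ext
    · simp [sub_div, h1'.ne']
    · simp
  rw [e0, key _ _ _ _ h1' h2', Complex.mk_eq_add_mul_I]
  push_cast
  rfl

theorem exists_approximable_sum_zetaCoeff {c : ℕ} (hc : 3 ≤ c) {R : ℕ} (hR : 2 ≤ R)
    {K B : ℕ → ℕ} (hK : LowElem K) (hB : LowElem B) (hKB : ∀ e, (R : ℝ) ^ K e ≤ B e) :
    ∃ G H : ((Fin 3 → ℕ) × (Fin 3 → ℕ)) × ℕ → ℝ, Approximable G ∧ Approximable H ∧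
      ∀ (a b : ℚ) (e : ℕ), (a : ℝ) ≤ c → (c : ℝ) - a ≤ R → |(b : ℝ)| ≤ R →
        ∑ k ∈ Finset.range (K e), (zetaCoeff c k : ℂ) * ((c : ℂ) - ⟨(a : ℝ), (b : ℝ)⟩) ^ k =
          G ((ratCode a, ratCode b), e) + H ((ratCode a, ratCode b), e) * Complex.I := by
  have hs : ∀ i : Fin 3, LowElem (fun x : ((Fin 3 → ℕ) × (Fin 3 → ℕ)) × ℕ => x.1.1 i) :=
    fun i => LowElem.apply (by fun_prop) i
  have ht : ∀ i : Fin 3, LowElem (fun x : ((Fin 3 → ℕ) × (Fin 3 → ℕ)) × ℕ => x.1.2 i) :=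
    fun i => LowElem.apply (by fun_prop) i
  -- As a ≤ c, the real part c - a is a fraction of naturals. The imaginary part -b is |b| with a
  -- sign: s = 1, that is I^3 = -I, when b > 0.
  obtain ⟨G, H, hG, hH, h⟩ := exists_approximable_sum_pow (approximable_zetaCoeff hc) hR
    (((((LowElem.const c).mul (hs 2)).add (hs 1)).sub (hs 0))) (hs 2) ((ht 0).add (ht 1)) (ht 2)
    (LowElem.ite ((LowElem.const 0).lt (ht 0)) (LowElem.const 1) (LowElem.const 0))
    (hK.comp lowElem_snd) (hB.comp lowElem_snd) (fun x => hKB x.2)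
  refine ⟨G, H, hG, hH, fun a b e ha hca hb => ?_⟩
  obtain ⟨hs2, hsa, hs0⟩ := rat_ι_spec a
  obtain ⟨ht2, htb, ht0⟩ := rat_ι_spec b
  have h1 := h ((ratCode a, ratCode b), e) hs2 ht2
  dsimp only at h1
  generalize ratCode a = s at *
  generalize ratCode b = t at *
  have hs2' : (0 : ℝ) < s 2 := by exact_mod_cast hs2
  have ht2' : (0 : ℝ) < t 2 := by exact_mod_cast ht2
  have hle : s 0 ≤ c * s 2 + s 1 := by
    rw [← hsa, div_le_iff₀ hs2'] at ha
    have : (s 0 : ℝ) ≤ (c * s 2 + s 1 : ℕ) := by push_cast; linarith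
    exact_mod_cast this
  have hU : ((c * s 2 + s 1 - s 0 : ℕ) : ℝ) / s 2 = c - a := by
    rw [Nat.cast_sub hle, ← hsa]
    push_cast
    field_simp
    ring
  have hV : ((t 0 + t 1 : ℕ) : ℝ) / t 2 = |(b : ℝ)| := by
    rw [← htb, abs_div, abs_of_pos ht2']
    congr 1
    rcases ht0 with h0 | h0
    · simp [h0]
    · simp [h0]
  have hw : (((c * s 2 + s 1 - s 0 : ℕ) : ℝ) / s 2 : ℝ) + (((t 0 + t 1 : ℕ) : ℝ) / t 2 : ℝ) *
      Complex.I ^ (2 * (if 0 < t 0 then 1 else 0) + 1) = (c : ℂ) - ⟨(a : ℝ), (b : ℝ)⟩ := by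
    have hbI : ((|(b : ℝ)| : ℝ) : ℂ) * Complex.I ^ (2 * (if 0 < t 0 then 1 else 0) + 1) =
        -((b : ℝ) : ℂ) * Complex.I := by
      rcases Nat.eq_zero_or_pos (t 0) with h0 | h0
      · have : (b : ℝ) ≤ 0 := by
          rw [← htb, h0]
          exact div_nonpos_of_nonpos_of_nonneg (by simp) ht2'.le
        rw [abs_of_nonpos this]
        simp [h0]
      · have h00 : t 1 = 0 := ht0.resolve_left h0.ne'
        have : 0 ≤ (b : ℝ) := by
          rw [← htb, h00]
          simp only [Nat.cast_zero, sub_zero]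
          positivity
        rw [abs_of_nonneg this]
        simp [h0, Complex.I_pow_three]
    rw [hU, hV, hbI, Complex.mk_eq_add_mul_I]
    push_cast
    ring
  have hUR : c * s 2 + s 1 - s 0 ≤ R * s 2 := by
    rw [← hU, div_le_iff₀ hs2'] at hca
    exact_mod_cast hca
  have hVR : t 0 + t 1 ≤ R * t 2 := by
    rw [← hV, div_le_iff₀ ht2'] at hb
    exact_mod_cast hb
  rw [← h1 hUR hVR, hw]

theorem norm_mk_sub_mk_le (x y : Fin 2 → ℝ) :
    ‖(⟨x 0, x 1⟩ : ℂ) - ⟨y 0, y 1⟩‖ ≤ 2 * dist x y := by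
  have h := Complex.norm_le_abs_re_add_abs_im ((⟨x 0, x 1⟩ : ℂ) - ⟨y 0, y 1⟩)
  have h0 := dist_le_pi_dist x y 0
  have h1 := dist_le_pi_dist x y 1
  rw [Real.dist_eq] at h0 h1
  simp only [Complex.sub_re, Complex.sub_im] at h
  linarith

theorem norm_inv_sub_inv_le {z w : ℂ} {e : ℝ} (he : 0 < e) (hz : 1 / e ≤ ‖z‖)
    (hzw : ‖z - w‖ ≤ 1 / (2 * e)) : ‖z⁻¹ - w⁻¹‖ ≤ 2 * e ^ 2 * ‖z - w‖ := by
  have hw : 1 / (2 * e) ≤ ‖w‖ := by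
    have h1 := norm_sub_norm_le z w
    have h2 : 1 / e = 1 / (2 * e) + 1 / (2 * e) := by field_simp; norm_num
    linarith
  have hz0 : z ≠ 0 := norm_pos_iff.1 (lt_of_lt_of_le (by positivity) hz)
  have hw0 : w ≠ 0 := norm_pos_iff.1 (lt_of_lt_of_le (by positivity) hw)
  rw [inv_sub_inv hz0 hw0, norm_div, norm_mul, norm_sub_rev, div_eq_mul_inv, mul_comm]
  gcongr
  have h3 : 1 / (2 * e ^ 2) ≤ ‖z‖ * ‖w‖ := by
    calc 1 / (2 * e ^ 2) = 1 / e * (1 / (2 * e)) := by field_simp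
      _ ≤ _ := by gcongr
  calc _ ≤ (1 / (2 * e ^ 2))⁻¹ := by gcongr
    _ = _ := by field_simp

/-- The point 1 lies outside the punctured disk, so it has maximum-norm distance at least 1/e from
x, and the Euclidean norm is larger. -/
theorem one_div_le_norm_sub_one {r : ℝ} {e : ℕ} {x : Fin 2 → ℝ}
    (hx : x ∈ innerPart {x : Fin 2 → ℝ | (⟨x 0, x 1⟩ : ℂ) ∈ {z : ℂ | 0 < ‖z - 1‖ ∧ ‖z - 1‖ < r}} e) :
    1 / (e : ℝ) ≤ ‖(⟨x 0, x 1⟩ : ℂ) - 1‖ := by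
  have h1 : (⟨1, 0⟩ : ℂ) = 1 := rfl
  have h := hx.2.2 ![1, 0] (by simp [h1])
  refine h.trans ((dist_pi_le_iff (norm_nonneg _)).2 fun i => ?_)
  fin_cases i
  · simpa [Real.dist_eq] using Complex.abs_re_le_norm ((⟨x 0, x 1⟩ : ℂ) - 1)
  · simpa [Real.dist_eq] using Complex.abs_im_le_norm ((⟨x 0, x 1⟩ : ℂ) - 1)

end GoodClasses

/-! ### The main theorem -/

open GoodClasses in
theorem mainTheorem12 (r : ℝ) (hr : 0 < r) :
    GoodClasses.IsLowerElementaryOn riemannZeta {z : ℂ | 0 < ‖z - 1‖ ∧ ‖z - 1‖ < r} := by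
  -- For |w - 1| ≤ r + 1 this choice gives Re w ≤ c and |c - w| ≤ c + r + 2 ≤ 2c.
  obtain ⟨c, hc3, hcr⟩ : ∃ c : ℕ, 3 ≤ c ∧ r + 3 ≤ c :=
    ⟨⌈r⌉₊ + 3, by omega, by push_cast; linarith [Nat.le_ceil r]⟩
  have hR2 : 2 ≤ 2 * c := by omega
  obtain ⟨M, hM, hMK⟩ := exists_norm_sum_zetaCoeff_sub_le hc3 (R := (2 * c : ℕ)) (by positivity)
  obtain ⟨L, hL, hLip⟩ := exists_lipschitz_zetaReg (r + 1)
  obtain ⟨M', hM'⟩ := exists_nat_ge M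
  obtain ⟨L', hL'⟩ := exists_nat_ge L
  obtain ⟨K₀, hK₀, hlog⟩ := exists_lowElem_log_le
  obtain ⟨B, hB, hKB⟩ := exists_lowElem_pow_le (2 * c) (fun e => (hlog e).2)
  -- Then M exp(-K) ≤ M'/(6M'e + 1) ≤ 1/(6e).
  have hC : LowElem (fun e : ℕ => 6 * M' * e) := by fun_prop
  obtain ⟨G, H, hG, hH, hGH⟩ := exists_approximable_sum_zetaCoeff hc3 hR2 (hK₀.comp hC)
    (hB.comp hC) (fun e => hKB _)
  obtain ⟨G₁, H₁, hG₁, hH₁, hGH₁⟩ := exists_approximable_inv_sub_one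
  have hone : Approximable (fun _ : ((Fin 3 → ℕ) × (Fin 3 → ℕ)) × ℕ => (1 : ℝ)) := by
    simpa using approximable_natCast (α := ((Fin 3 → ℕ) × (Fin 3 → ℕ)) × ℕ) 1
  -- The cube in d absorbs the factor 2e² from the inverse and leaves 1/(6e); L' handles the
  -- Lipschitz constant of the entire part, and a factor 2 is lost between the norms.
  refine functionIn_of_approximable (d := fun e => 24 * (L' + 1) * (e + 1) ^ 3)
    (fun a b hab => ?_) (by fun_prop)
    (H := ![fun x => 1 + (G₁ x.1 + G x), fun x => H₁ x.1 + H x]) (fun j => ?_)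
    fun e he a x hx hxa => ?_
  · dsimp only
    gcongr
  · fin_cases j
    · exact hone.add ((hG₁.comp lowElem_fst).add hG)
    · exact (hH₁.comp lowElem_fst).add hH
  · set z : ℂ := ⟨x 0, x 1⟩ with hz
    set w : ℂ := ⟨(a 0 : ℝ), (a 1 : ℝ)⟩ with hw
    have he1 : (1 : ℝ) ≤ e := by exact_mod_cast he
    have he0 : (0 : ℝ) < e := by linarith
    have hL'0 : (0 : ℝ) ≤ L' := L'.cast_nonneg
    have hze : 1 / (e : ℝ) ≤ ‖z - 1‖ := one_div_le_norm_sub_one hx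
    have hzr : ‖z - 1‖ < r := hx.1.2
    have hz1 : z ≠ 1 := by
      rintro h
      rw [h, sub_self, norm_zero] at hze
      exact absurd hze (not_le.2 (by positivity))
    have hzw : ‖z - w‖ ≤ 1 / (12 * (L' + 1) * e ^ 3) := by
      have h1 := norm_mk_sub_mk_le x (fun i => (a i : ℝ))
      have h2 : (1 : ℝ) / ((24 * (L' + 1) * (e + 1) ^ 3 : ℕ) : ℝ) ≤
          1 / (24 * (L' + 1) * (e : ℝ) ^ 3) := by
        push_cast
        gcongr
        linarith
      calc ‖z - w‖ ≤ _ := h1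
        _ ≤ 2 * (1 / (24 * (L' + 1) * (e : ℝ) ^ 3)) := by linarith
        _ = _ := by field_simp; norm_num
    have hcube : (e : ℝ) ≤ e ^ 3 := le_self_pow₀ he1 three_ne_zero
    have hzw2 : ‖z - w‖ ≤ 1 / (2 * e) := by
      refine hzw.trans ?_
      gcongr
      linarith
    have hzw1 : ‖z - w‖ ≤ 1 := by
      refine hzw2.trans ?_
      rw [div_le_one (by positivity)]
      linarith
    have hwr : ‖w - 1‖ ≤ r + 1 := by
      have : w - 1 = (z - 1) - (z - w) := by ring
      rw [this]
      linarith [norm_sub_le (z - 1) (z - w)]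
    have hcw : ‖(c : ℂ) - w‖ ≤ (2 * c : ℕ) := by
      have h1 : (c : ℂ) - w = (c : ℂ) - (1 + (w - 1)) := by ring
      rw [h1]
      have h2 := norm_sub_le (c : ℂ) (1 + (w - 1))
      have h3 := norm_add_le (1 : ℂ) (w - 1)
      rw [Complex.norm_natCast] at h2
      rw [norm_one] at h3
      push_cast
      linarith
    have hare : (a 0 : ℝ) ≤ c := by
      have h1 := (Complex.re_le_norm (w - 1)).trans hwr
      have h2 : (w - 1).re = (a 0 : ℝ) - 1 := by simp [hw]
      linarith
    have hcre : (c : ℝ) - a 0 ≤ (2 * c : ℕ) := by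
      have h1 := (Complex.re_le_norm ((c : ℂ) - w)).trans hcw
      simpa [hw] using h1
    have hcim : |(a 1 : ℝ)| ≤ (2 * c : ℕ) := by
      have h1 := (Complex.abs_im_le_norm ((c : ℂ) - w)).trans hcw
      simpa [hw] using h1
    -- Pole term, moving from z to w in the entire part, and truncation cost 1/(6e) each.
    have key : ‖riemannZeta z - (1 + ((w - 1)⁻¹ + ∑ k ∈ Finset.range (K₀ (6 * M' * e)),
        (zetaCoeff c k : ℂ) * ((c : ℂ) - w) ^ k))‖ ≤ 1 / (2 * (e : ℝ)) := by
      have h1 : ‖(z - 1)⁻¹ - (w - 1)⁻¹‖ ≤ 1 / (6 * (e : ℝ)) := by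
        have e1 : (z - 1) - (w - 1) = z - w := by ring
        have h := norm_inv_sub_inv_le he0 hze (by rwa [e1])
        rw [e1] at h
        refine h.trans ?_
        calc 2 * (e : ℝ) ^ 2 * ‖z - w‖ ≤
              2 * (e : ℝ) ^ 2 * (1 / (12 * ((L' : ℝ) + 1) * (e : ℝ) ^ 3)) := by gcongr
          _ = 1 / (6 * (e : ℝ)) * (1 / ((L' : ℝ) + 1)) := by field_simp; norm_num
          _ ≤ 1 / (6 * (e : ℝ)) * 1 := by
              gcongr
              rw [div_le_one (by positivity)]
              linarith
          _ = _ := mul_one _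
      have h2 : ‖zetaReg z - zetaReg w‖ ≤ 1 / (6 * (e : ℝ)) := by
        refine (hLip z (by rw [mem_closedBall_iff_norm]; linarith) w
          (by rwa [mem_closedBall_iff_norm])).trans ?_
        calc L * ‖z - w‖ ≤ (L' + 1) * (1 / (12 * (L' + 1) * e ^ 3)) := by
              gcongr
              linarith
          _ = 1 / (12 * e ^ 3) := by field_simp
          _ ≤ _ := by
              gcongr
              norm_num
      have h3 := hMK w hcw (K₀ (6 * M' * e))
      have h4 : M * Real.exp (-(K₀ (6 * M' * e) : ℝ)) ≤ 1 / (6 * (e : ℝ)) := by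
        have hl := (hlog (6 * M' * e)).1
        have hM0 : (0 : ℝ) < M' := hM.trans_le hM'
        calc M * Real.exp (-(K₀ (6 * M' * e) : ℝ)) ≤
              M' * Real.exp (-Real.log (6 * M' * e + 1 : ℕ)) := by gcongr
          _ = M' / (6 * M' * e + 1) := by
              rw [Real.exp_neg, Real.exp_log (by positivity)]
              push_cast
              rfl
          _ ≤ M' / (6 * M' * e) := by gcongr; linarith
          _ = _ := by field_simp
      have hzeta : riemannZeta z = 1 + ((z - 1)⁻¹ + zetaReg z) := by
        rw [zetaReg_of_ne hz1]
        ring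
      rw [hzeta]
      set S := ∑ k ∈ Finset.range (K₀ (6 * M' * e)), (zetaCoeff c k : ℂ) * ((c : ℂ) - w) ^ k
      have e2 : 1 + ((z - 1)⁻¹ + zetaReg z) - (1 + ((w - 1)⁻¹ + S)) =
          ((z - 1)⁻¹ - (w - 1)⁻¹) + (zetaReg z - zetaReg w) - (S - zetaReg w) := by ring
      rw [e2]
      calc _ ≤ _ := norm_sub_le _ _
        _ ≤ (1 / (6 * (e : ℝ)) + 1 / (6 * (e : ℝ))) + 1 / (6 * (e : ℝ)) :=
            add_le_add ((norm_add_le _ _).trans (add_le_add h1 h2)) (h3.trans h4)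
        _ = _ := by field_simp; norm_num
    have hinv := hGH₁ (ratCode (a 0)) (ratCode (a 1)) (rat_ι_spec (a 0)).1 (rat_ι_spec (a 1)).1
    rw [(rat_ι_spec (a 0)).2.1, (rat_ι_spec (a 1)).2.1, ← hw] at hinv
    rw [hinv, hGH (a 0) (a 1) e hare hcre hcim] at key
    intro j
    fin_cases j
    · simpa using (Complex.abs_re_le_norm _).trans key
    · simpa using (Complex.abs_im_le_norm _).trans key
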